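/- Let $\mathcal A(\mathbb R)$ be one of the spaces $C^\infty_c(\mathbb R)$, $\mathcal S(\mathbb R)$ (Schwartz functions) or $W^{\infty,1}(\mathbb R)=\{f\in C^\infty(\mathbb R): f^{(k)}\in L^1(\mathbb R)\text{ for all }k\ge 0\}$ of real-valued functions, let $\mathcal A_1(\mathbb R)=\{f\in C^\infty(\mathbb R): f'\in\mathcal A(\mathbb R),\ \lim_{x\to-\infty}f(x)=0\}$, and put $$\mathrm{Diff}_{\mathcal A_1}(\mathbb R)=\{\varphi=\mathrm{Id}+f: f\in\mathcal A_1(\mathbb R),\ f'>-1\},\qquad \mathcal A(\mathbb R,\mathbb R_{>-2})=\{\gamma\in\mathcal A(\mathbb R):\gamma(x)>-2\text{ for all }x\}.$$ Smoothness is understood in the sense of convenient calculus: a map is smooth if it sends smooth curves to smooth curves, where a smooth curve in $\mathcal A(\mathbb R)$ is a function $f\in C^\infty(\mathbb R^2)$, $(t,x)\mapsto f(t,x)$, such that each $\partial_t^k\partial_x^n f(t,\cdot)$ is, locally uniformly in $t$, supported in a fixed compact set (for $C_c^\infty$), $O((1+x^2)^{-m})$ for every $m$ (for $\mathcal S$),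 respectively bounded in $L^1$ (for $W^{\infty,1}$); a smooth curve in $\mathcal A_1(\mathbb R)$ is an $f\in C^\infty(\mathbb R^2)$ with $\partial_xf$ a smooth curve in $\mathcal A(\mathbb R)$ and $f(t,-\infty)=0$ for all $t$. The manifold $\mathrm{Diff}_{\mathcal A_1}(\mathbb R)$ is modelled on $\mathcal A_1(\mathbb R)$ through $\varphi\mapsto\varphi-\mathrm{Id}$. Each $\varphi\in\mathrm{Diff}_{\mathcal A_1}(\mathbb R)$ is a bijection of $\mathbb R$, its tangent space is $T_\varphi\mathrm{Diff}_{\mathcal A_1}(\mathbb R)=\mathcal A_1(\mathbb R)=\{X\circ\varphi: X\in\mathcal A_1(\mathbb R)\}$, and the right-invariant homogeneous $\dot H^1$-metric is $$\langle X\circ\varphi,Y\circ\varphi\rangle_{\dot H^1}=\int_{\mathbb R}X'(x)Y'(x)\,dx,\qquad X,Y\in\mathcal A_1(\mathbb R).$$ On $\mathcal A(\mathbb R,\mathbb R_{>-2})$ consider the (flat) $L^2$-metric $\langle h,k\rangle_{L^2}=\int_{\mathbb R}hk\,dx$, $h,k\in\mathcal A(\mathbb R)$. Then $\mathcal A(\mathbb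 R,\mathbb R_{>-2})$ is open in $\mathcal A(\mathbb R)$, and the map $$R:\mathrm{Diff}_{\mathcal A_1}(\mathbb R)\to\mathcal A(\mathbb R,\mathbb R_{>-2}),\qquad R(\varphi)=2\big((\varphi')^{1/2}-1\big),$$ is well defined, smooth and bijective, with smooth inverse $$R^{-1}(\gamma)(x)=x+\frac14\int_{-\infty}^x\big(\gamma(y)^2+4\gamma(y)\big)\,dy.$$ The pullback of the $L^2$-metric under $R$ is the $\dot H^1$-metric: $\langle T_\varphi R.h,T_\varphi R.k\rangle_{L^2}=\langle h,k\rangle_{\dot H^1}$ for all $\varphi\in\mathrm{Diff}_{\mathcal A_1}(\mathbb R)$ and $h,k\in T_\varphi\mathrm{Diff}_{\mathcal A_1}(\mathbb R)$. Consequently $\big(\mathrm{Diff}_{\mathcal A_1}(\mathbb R),\dot H^1\big)$ is a flat (weak) Riemannian manifold: its Levi-Civita covariant derivative exists and its Riemannian curvature vanishes. -/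

import Mathlib

open Filter MeasureTheory Set
open scoped Topology ContDiff SchwartzMap

noncomputable section

namespace SquareRootRep

/-- The three admissible function classes: smooth functions with compact support, rapidly
decreasing functions, and smooth functions all of whose derivatives are in `L¹`. -/
inductive FunctionClass
  | compactlySupported
  | schwartz
  | sobolevL1

/-- The function space `𝒜(ℝ)`: one of `C_c^∞(ℝ)`, `𝒮(ℝ)`, `W^{∞,1}(ℝ)`. -/
def space : FunctionClass → Set (ℝ → ℝ)
  | .compactlySupported => {f | ContDiff ℝ ∞ f ∧ HasCompactSupport f}
  | .schwartz => range (fun f : 𝓢(ℝ, ℝ) => (f : ℝ → ℝ))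
  | .sobolevL1 => {f | ContDiff ℝ ∞ f ∧ ∀ n : ℕ, Integrable (iteratedDeriv n f)}

/-- The space `𝒜₁(ℝ)` of antiderivatives of functions in `𝒜(ℝ)` which vanish at `-∞`. -/
def space₁ (A : FunctionClass) : Set (ℝ → ℝ) :=
  {f | ContDiff ℝ ∞ f ∧ deriv f ∈ space A ∧ Tendsto f atBot (𝓝 0)}

/-- `g(t, ·)` satisfies the decay condition of the class, locally uniformly in `t`. -/
def LocallyControlled : FunctionClass → (ℝ → ℝ → ℝ) → Prop
  | .compactlySupported, g =>
      ∀ T : ℝ, ∃ r : ℝ, ∀ t ∈ Icc (-T) T, ∀ x : ℝ, r < |x| → g t x = 0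
  | .schwartz, g =>
      ∀ T : ℝ, ∀ m : ℕ, ∃ C : ℝ, ∀ t ∈ Icc (-T) T, ∀ x : ℝ, (1 + x ^ 2) ^ m * |g t x| ≤ C
  | .sobolevL1, g =>
      ∀ T : ℝ, ∃ C : ℝ, ∀ t ∈ Icc (-T) T, Integrable (g t) ∧ ∫ x, |g t x| ≤ C

/-- Smooth curves `ℝ → 𝒜(ℝ)`: smooth functions `f(t, x)` of two variables such that every
`∂ₜᵏ∂ₓⁿ f(t, ·)` satisfies the decay condition of `𝒜(ℝ)` locally uniformly in `t`. -/
def curves (A : FunctionClass) : Set (ℝ → ℝ → ℝ) :=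
  {f | ContDiff ℝ ∞ (Function.uncurry f) ∧
    ∀ k n : ℕ, LocallyControlled A
      (fun t x => iteratedDeriv k (fun s => iteratedDeriv n (f s) x) t)}

/-- Smooth curves `ℝ → 𝒜₁(ℝ)`. -/
def curves₁ (A : FunctionClass) : Set (ℝ → ℝ → ℝ) :=
  {f | ContDiff ℝ ∞ (Function.uncurry f) ∧ (fun t => deriv (f t)) ∈ curves A ∧
    ∀ t, Tendsto (f t) atBot (𝓝 0)}

/-- The data of a manifold of functions that is an open piece of an affine space: its points and
smooth curves, and the vectors and smooth curves of the model space. The tangent space at every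
point is the model space. Smoothness is that of convenient calculus, that is, it is tested along
smooth curves. -/
structure FunctionManifold where
  /-- the points -/
  carrier : Set (ℝ → ℝ)
  /-- the smooth curves of points -/
  curves : Set (ℝ → ℝ → ℝ)
  /-- the tangent vectors -/
  model : Set (ℝ → ℝ)
  /-- the smooth curves of tangent vectors -/
  modelCurves : Set (ℝ → ℝ → ℝ)

/-- The group `Diff_{𝒜₁}(ℝ) = {Id + f : f ∈ 𝒜₁(ℝ), f' > -1}`, modelled on `𝒜₁(ℝ)`. -/
def diffGroup (A : FunctionClass) : FunctionManifold where
  carrier := {φ | (fun x => φ x - x) ∈ space₁ A ∧ ∀ x, -1 < deriv (fun y => φ y - y) x}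
  curves := {c | (∀ t, (fun x => c t x - x) ∈ space₁ A ∧ ∀ x, -1 < deriv (fun y => c t y - y) x) ∧
    (fun t x => c t x - x) ∈ curves₁ A}
  model := space₁ A
  modelCurves := curves₁ A

/-- The set `𝒜(ℝ, ℝ_{>-2}) = {γ ∈ 𝒜(ℝ) : γ > -2}`, modelled on `𝒜(ℝ)`. -/
def target (A : FunctionClass) : FunctionManifold where
  carrier := {γ | γ ∈ space A ∧ ∀ x, -2 < γ x}
  curves := {c | (∀ t, c t ∈ space A ∧ ∀ x, -2 < c t x) ∧ c ∈ curves A}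
  model := space A
  modelCurves := curves A

/-- A map is smooth if it sends smooth curves to smooth curves. -/
def IsSmoothMap (M N : FunctionManifold) (F : (ℝ → ℝ) → (ℝ → ℝ)) : Prop :=
  MapsTo F M.carrier N.carrier ∧ ∀ c ∈ M.curves, (fun t => F (c t)) ∈ N.curves

/-- The velocity `∂ₜ c(t)` of a curve of functions. -/
def velocity (c : ℝ → ℝ → ℝ) (t : ℝ) : ℝ → ℝ :=
  fun x => deriv (fun s => c s x) t

/-- The tangent map `T_φ F . h = ∂ₜ|₀ F(φ + t h)`. -/
def tangentMap (F : (ℝ → ℝ) → (ℝ → ℝ)) (φ h : ℝ → ℝ) : ℝ → ℝ :=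
  fun x => deriv (fun t : ℝ => F (φ + t • h) x) 0

/-- A field of bilinear forms `G_φ(h, k)`. -/
abbrev MetricField := (ℝ → ℝ) → (ℝ → ℝ) → (ℝ → ℝ) → ℝ

/-- The pullback `(F^* G)_φ(h, k) = G_{F(φ)}(T_φ F . h, T_φ F . k)`. -/
def pullback (F : (ℝ → ℝ) → (ℝ → ℝ)) (G : MetricField) : MetricField :=
  fun φ h k => G (F φ) (tangentMap F φ h) (tangentMap F φ k)

/-- Smooth weak Riemannian metrics. -/
structure IsRiemannianMetric (M : FunctionManifold) (G : MetricField) : Prop where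
  add_left : ∀ φ ∈ M.carrier, ∀ h₁ ∈ M.model, ∀ h₂ ∈ M.model, ∀ k ∈ M.model,
    G φ (h₁ + h₂) k = G φ h₁ k + G φ h₂ k
  smul_left : ∀ φ ∈ M.carrier, ∀ a : ℝ, ∀ h ∈ M.model, ∀ k ∈ M.model,
    G φ (a • h) k = a * G φ h k
  symm : ∀ φ ∈ M.carrier, ∀ h ∈ M.model, ∀ k ∈ M.model, G φ h k = G φ k h
  pos : ∀ φ ∈ M.carrier, ∀ h ∈ M.model, h ≠ 0 → 0 < G φ h h
  smooth : ∀ c ∈ M.curves, ∀ h ∈ M.modelCurves, ∀ k ∈ M.modelCurves,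
    ContDiff ℝ ∞ (fun t => G (c t) (h t) (k t))

/-- Christoffel symbols `Γ_φ(h, k)`; the covariant derivative of vector fields is
`∇_X Y = dY.X + Γ(X, Y)`. -/
abbrev Christoffel := (ℝ → ℝ) → (ℝ → ℝ) → (ℝ → ℝ) → (ℝ → ℝ)

/-- The covariant derivative `∇_{∂ₜ} h = ∂ₜ h + Γ_c(∂ₜ c, h)` of a vector field `h` along `c`. -/
def covDeriv (Γ : Christoffel) (c h : ℝ → ℝ → ℝ) (t : ℝ) : ℝ → ℝ :=
  velocity h t + Γ (c t) (velocity c t) (h t)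

/-- `Γ` defines a Levi-Civita covariant derivative of `G`: it is smooth and bilinear, symmetric
(torsion-free), and compatible with the metric. -/
structure IsLeviCivita (M : FunctionManifold) (G : MetricField) (Γ : Christoffel) : Prop where
  mem : ∀ φ ∈ M.carrier, ∀ h ∈ M.model, ∀ k ∈ M.model, Γ φ h k ∈ M.model
  smooth : ∀ c ∈ M.curves, ∀ h ∈ M.modelCurves, ∀ k ∈ M.modelCurves,
    (fun t => Γ (c t) (h t) (k t)) ∈ M.modelCurves
  add_left : ∀ φ ∈ M.carrier, ∀ h₁ ∈ M.model, ∀ h₂ ∈ M.model, ∀ k ∈ M.model,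
    Γ φ (h₁ + h₂) k = Γ φ h₁ k + Γ φ h₂ k
  smul_left : ∀ φ ∈ M.carrier, ∀ a : ℝ, ∀ h ∈ M.model, ∀ k ∈ M.model,
    Γ φ (a • h) k = a • Γ φ h k
  symm : ∀ φ ∈ M.carrier, ∀ h ∈ M.model, ∀ k ∈ M.model, Γ φ h k = Γ φ k h
  metric : ∀ c ∈ M.curves, ∀ h ∈ M.modelCurves, ∀ k ∈ M.modelCurves, ∀ t : ℝ,
    HasDerivAt (fun s => G (c s) (h s) (k s))
      (G (c t) (covDeriv Γ c h t) (k t) + G (c t) (h t) (covDeriv Γ c k t)) t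

/-- The Riemannian curvature `ℛ_φ(h, k) l` of the covariant derivative given by `Γ`. -/
def curvature (Γ : Christoffel) (φ h k l : ℝ → ℝ) : ℝ → ℝ :=
  tangentMap (fun ψ => Γ ψ k l) φ h - tangentMap (fun ψ => Γ ψ h l) φ k
    + Γ φ h (Γ φ k l) - Γ φ k (Γ φ h l)

/-- `(M, G)` is a flat Riemannian manifold: `G` is a weak Riemannian metric whose Levi-Civita
covariant derivative exists and has vanishing curvature. -/
def IsFlat (M : FunctionManifold) (G : MetricField) : Prop :=
  IsRiemannianMetric M G ∧
  (∃ Γ, IsLeviCivita M G Γ) ∧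
  ∀ Γ, IsLeviCivita M G Γ →
    ∀ φ ∈ M.carrier, ∀ h ∈ M.model, ∀ k ∈ M.model, ∀ l ∈ M.model, curvature Γ φ h k l = 0

/-- The `L²`-metric, independent of the base point. -/
def metricL2 : MetricField := fun _ h k => ∫ x, h x * k x

/-- The `Ḣ¹`-inner product `∫ X' Y' dx` on the Lie algebra. -/
def innerHdot (X Y : ℝ → ℝ) : ℝ := ∫ x, deriv X x * deriv Y x

/-- The right-invariant `Ḣ¹`-metric `G_φ(h, k) = G_Id(h ∘ φ⁻¹, k ∘ φ⁻¹)`. -/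
def metricHdot : MetricField := fun φ h k =>
  innerHdot (h ∘ Function.invFun φ) (k ∘ Function.invFun φ)

/-- `R(φ) = 2 ((φ')^{1/2} - 1)`. -/
def rMap (φ : ℝ → ℝ) : ℝ → ℝ := fun x => 2 * (√(deriv φ x) - 1)

/-- `γ ↦ x + ¼ ∫_{-∞}^x (γ² + 4γ)`. -/
def rInv (γ : ℝ → ℝ) : ℝ → ℝ := fun x => x + 1 / 4 * ∫ y in Iic x, (γ y ^ 2 + 4 * γ y)

end SquareRootRep

end

/-! The map `R` only sees the derivative: it is the superposition of `φ' - 1` with `Φ(y) = 2(√(1 +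
y) - 1)`, which is smooth on `(-1, ∞)` and fixes `0`. Since `1 + R(φ)/2 = √φ'`, squaring recovers
`φ' = 1 + (γ² + 4γ)/4`, and integrating from `-∞` recovers `φ`. Differentiating gives `T_φ R.h =
h'/√φ'`, so the pulled back `L²` product is `∫ h'k'/φ'`; the substitution `y = φ(x)` turns the
right-invariant `Ḣ¹` product into the same integral (`metricHdot_eq`).

Smoothness reduces to stability of the class of smooth curves. All three decay conditions imply the
`W^{∞,1}` one, which gives bounds in `L^∞` for all derivatives (`Controlled.locallyBounded`). A
curve that stays above `a < 0` does so with a locally uniform gap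
(`Controlled.locallyBoundedBelow`), whence superposition preserves the class
(`Controlled.comp_outer_zero`), and spatial antiderivatives are jointly smooth
(`Controlled.smooth_antideriv`).

Flatness is verified in coordinates. Two Levi-Civita derivatives agree by the Koszul argument, which
needs only definiteness of the weak metric (`IsLeviCivita.unique`), so one explicit candidate
suffices. For `L²` it is `Γ = 0`. For `Ḣ¹` it is the transport of the trivial connection by `R`,
with `Γ_φ(h, k)' = -½ h'k'/φ'`; both `dΓ` and `Γ(h, Γ(k, l))` are then symmetric in the two
curvature arguments and cancel. -/

noncomputable section

namespace SquareRootRep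

/-! ### Partial derivatives of functions of two variables -/

/-- Joint smoothness of a function of two real variables. -/
abbrev Smooth₂ (f : ℝ → ℝ → ℝ) : Prop := ContDiff ℝ ∞ (Function.uncurry f)

/-- The derivative in the space variable. -/
def spaceDeriv (f : ℝ → ℝ → ℝ) : ℝ → ℝ → ℝ := fun t => deriv (f t)

section PartialDerivatives

variable {f g : ℝ → ℝ → ℝ}

lemma Smooth₂.comp_left (hf : Smooth₂ f) (x : ℝ) : ContDiff ℝ ∞ (fun s => f s x) :=
  hf.comp (contDiff_id.prodMk contDiff_const)

lemma Smooth₂.comp_right (hf : Smooth₂ f) (t : ℝ) : ContDiff ℝ ∞ (f t) :=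
  hf.comp (contDiff_const.prodMk contDiff_id)

lemma Smooth₂.hasDerivAt_left (hf : Smooth₂ f) (t x : ℝ) :
    HasDerivAt (fun s => f s x) (velocity f t x) t :=
  ((hf.comp_left x).differentiable (by simp) t).hasDerivAt

lemma Smooth₂.hasDerivAt_right (hf : Smooth₂ f) (t x : ℝ) :
    HasDerivAt (f t) (spaceDeriv f t x) x :=
  ((hf.comp_right t).differentiable (by simp) x).hasDerivAt

lemma Smooth₂.velocity_eq_fderiv (hf : Smooth₂ f) (t x : ℝ) :
    velocity f t x = fderiv ℝ (Function.uncurry f) (t, x) (1, 0) := by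
  have h1 : HasDerivAt (fun s : ℝ => (s, x)) (1, 0) t :=
    (hasDerivAt_id t).prodMk (hasDerivAt_const t x)
  exact (((hf.differentiable (by simp)) (t, x)).hasFDerivAt.comp_hasDerivAt t h1).deriv

lemma Smooth₂.spaceDeriv_eq_fderiv (hf : Smooth₂ f) (t x : ℝ) :
    spaceDeriv f t x = fderiv ℝ (Function.uncurry f) (t, x) (0, 1) := by
  have h1 : HasDerivAt (fun s : ℝ => (t, s)) (0, 1) x :=
    (hasDerivAt_const x t).prodMk (hasDerivAt_id x)
  exact (((hf.differentiable (by simp)) (t, x)).hasFDerivAt.comp_hasDerivAt x h1).deriv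

lemma Smooth₂.fderiv_apply (hf : Smooth₂ f) (v : ℝ × ℝ) :
    ContDiff ℝ ∞ (fun p => fderiv ℝ (Function.uncurry f) p v) :=
  (hf.fderiv_right (m := ∞) (by simp)).clm_apply contDiff_const

lemma Smooth₂.velocity (hf : Smooth₂ f) : Smooth₂ (velocity f) := by
  have : Function.uncurry (SquareRootRep.velocity f) =
      fun p => fderiv ℝ (Function.uncurry f) p (1, 0) := by
    ext ⟨t, x⟩; exact hf.velocity_eq_fderiv t x
  rw [Smooth₂, this]; exact hf.fderiv_apply _

lemma Smooth₂.spaceDeriv (hf : Smooth₂ f) : Smooth₂ (spaceDeriv f) := by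
  have : Function.uncurry (SquareRootRep.spaceDeriv f) =
      fun p => fderiv ℝ (Function.uncurry f) p (0, 1) := by
    ext ⟨t, x⟩; exact hf.spaceDeriv_eq_fderiv t x
  rw [Smooth₂, this]; exact hf.fderiv_apply _

/-- Schwarz's theorem: both sides evaluate the symmetric second Fréchet derivative on the coordinate
vectors. -/
lemma Smooth₂.velocity_spaceDeriv (hf : Smooth₂ f) :
    SquareRootRep.velocity (SquareRootRep.spaceDeriv f) =
      SquareRootRep.spaceDeriv (SquareRootRep.velocity f) := by
  have e1 : Function.uncurry (SquareRootRep.velocity f) =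
      fun p => fderiv ℝ (Function.uncurry f) p (1, 0) := by
    ext ⟨t, x⟩; exact hf.velocity_eq_fderiv t x
  have e2 : Function.uncurry (SquareRootRep.spaceDeriv f) =
      fun p => fderiv ℝ (Function.uncurry f) p (0, 1) := by
    ext ⟨t, x⟩; exact hf.spaceDeriv_eq_fderiv t x
  have hd : Differentiable ℝ (fderiv ℝ (Function.uncurry f)) :=
    (hf.fderiv_right (m := ∞) (by simp)).differentiable (by simp)
  have e3 : ∀ (p v w : ℝ × ℝ), fderiv ℝ (fun p => fderiv ℝ (Function.uncurry f) p v) p w =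
      fderiv ℝ (fderiv ℝ (Function.uncurry f)) p w v := by
    intro p v w
    have h : HasFDerivAt (fun p => fderiv ℝ (Function.uncurry f) p v)
        ((ContinuousLinearMap.apply ℝ ℝ v).comp
          (fderiv ℝ (fderiv ℝ (Function.uncurry f)) p)) p :=
      (ContinuousLinearMap.apply ℝ ℝ v).hasFDerivAt.comp p (hd p).hasFDerivAt
    rw [h.fderiv]; rfl
  ext t x
  rw [hf.spaceDeriv.velocity_eq_fderiv, hf.velocity.spaceDeriv_eq_fderiv, e1, e2, e3, e3]
  exact (hf.contDiffAt.isSymmSndFDerivAt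
    (by simpa using (mod_cast le_top : ((2 : ℕ∞) : ℕ∞ω) ≤ ∞))) _ _

lemma Smooth₂.add (hf : Smooth₂ f) (hg : Smooth₂ g) : Smooth₂ (f + g) := ContDiff.add hf hg

lemma Smooth₂.mul (hf : Smooth₂ f) (hg : Smooth₂ g) : Smooth₂ (f * g) := ContDiff.mul hf hg

lemma velocity_add (hf : Smooth₂ f) (hg : Smooth₂ g) :
    velocity (f + g) = velocity f + velocity g := by
  ext t x; exact ((hf.hasDerivAt_left t x).add (hg.hasDerivAt_left t x)).deriv

lemma spaceDeriv_add (hf : Smooth₂ f) (hg : Smooth₂ g) :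
    spaceDeriv (f + g) = spaceDeriv f + spaceDeriv g := by
  ext t x; exact ((hf.hasDerivAt_right t x).add (hg.hasDerivAt_right t x)).deriv

lemma velocity_mul (hf : Smooth₂ f) (hg : Smooth₂ g) :
    velocity (f * g) = velocity f * g + f * velocity g := by
  ext t x; exact ((hf.hasDerivAt_left t x).mul (hg.hasDerivAt_left t x)).deriv

lemma spaceDeriv_mul (hf : Smooth₂ f) (hg : Smooth₂ g) :
    spaceDeriv (f * g) = spaceDeriv f * g + f * spaceDeriv g := by
  ext t x; exact ((hf.hasDerivAt_right t x).mul (hg.hasDerivAt_right t x)).deriv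

end PartialDerivatives

/-! ### Functions whose partial derivatives are all controlled -/

/-- All partial derivatives of `f` up to order `N` satisfy `P`. -/
def ControlledTo (P : (ℝ → ℝ → ℝ) → Prop) : ℕ → (ℝ → ℝ → ℝ) → Prop
  | 0, f => Smooth₂ f ∧ P f
  | N + 1, f => (Smooth₂ f ∧ P f) ∧ ControlledTo P N (velocity f) ∧
      ControlledTo P N (spaceDeriv f)

/-- All partial derivatives of `f` satisfy `P`. -/
def Controlled (P : (ℝ → ℝ → ℝ) → Prop) (f : ℝ → ℝ → ℝ) : Prop := ∀ N, ControlledTo P N f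

section Controlled

variable {P Q : (ℝ → ℝ → ℝ) → Prop} {f g : ℝ → ℝ → ℝ} {N : ℕ}

lemma ControlledTo.of_succ (h : ControlledTo P (N + 1) f) : ControlledTo P N f := by
  induction N generalizing f with
  | zero => exact h.1
  | succ N ih => exact ⟨h.1, ih h.2.1, ih h.2.2⟩

lemma Controlled.smooth (h : Controlled P f) : Smooth₂ f := (h 0).1

lemma Controlled.prop (h : Controlled P f) : P f := (h 0).2

lemma Controlled.velocity (h : Controlled P f) : Controlled P (velocity f) :=
  fun N => (h (N + 1)).2.1

lemma Controlled.spaceDeriv (h : Controlled P f) : Controlled P (spaceDeriv f) :=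
  fun N => (h (N + 1)).2.2

/-- Serves when the bound on `f` itself has a different reason from the bounds on its derivatives,
as for superposition. -/
lemma Controlled.of_partials (hs : Smooth₂ f) (hP : P f)
    (h1 : Controlled P (SquareRootRep.velocity f))
    (h2 : Controlled P (SquareRootRep.spaceDeriv f)) : Controlled P f
  | 0 => ⟨hs, hP⟩
  | N + 1 => ⟨⟨hs, hP⟩, h1 N, h2 N⟩

/-- The premise grants control of all derivatives before asking for `Q`, so that `Q f` may be
deduced from bounds on `∂ₓ f`. -/
lemma ControlledTo.imp (hPQ : ∀ f, Controlled P f → Q f) (hf : Controlled P f) :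
    ControlledTo Q N f := by
  induction N generalizing f with
  | zero => exact ⟨hf.smooth, hPQ f hf⟩
  | succ N ih => exact ⟨⟨hf.smooth, hPQ f hf⟩, ih hf.velocity, ih hf.spaceDeriv⟩

lemma Controlled.imp (hPQ : ∀ f, Controlled P f → Q f) (hf : Controlled P f) :
    Controlled Q f := fun _ => ControlledTo.imp hPQ hf

lemma Smooth₂.velocity_iterate_spaceDeriv (hf : Smooth₂ f) (k : ℕ) :
    SquareRootRep.velocity (SquareRootRep.spaceDeriv^[k] f) =
      SquareRootRep.spaceDeriv^[k] (SquareRootRep.velocity f) := by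
  induction k generalizing f with
  | zero => rfl
  | succ k ih =>
    simp only [Function.iterate_succ, Function.comp]
    rw [ih hf.spaceDeriv, hf.velocity_spaceDeriv]

/-- The recursive form suits induction on the order; the form `∂ₜᵏ∂ₓⁿ` is the one defining `curves`.
They agree because mixed derivatives can be reordered. -/
lemma controlled_iff : Controlled P f ↔
    Smooth₂ f ∧ ∀ k n, P (SquareRootRep.velocity^[k] (SquareRootRep.spaceDeriv^[n] f)) := by
  constructor
  · refine fun h => ⟨h.smooth, fun k n => ?_⟩
    have h1 : ∀ n f, Controlled P f → Controlled P (SquareRootRep.spaceDeriv^[n] f) := by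
      intro n
      induction n with
      | zero => exact fun f hf => hf
      | succ n ih => exact fun f hf => ih _ hf.spaceDeriv
    have h2 : ∀ n f, Controlled P f → Controlled P (SquareRootRep.velocity^[n] f) := by
      intro n
      induction n with
      | zero => exact fun f hf => hf
      | succ n ih => exact fun f hf => ih _ hf.velocity
    exact (h2 k _ (h1 n _ h)).prop
  · rintro ⟨hs, h⟩ N
    induction N generalizing f with
    | zero => exact ⟨hs, h 0 0⟩
    | succ N ih =>
      refine ⟨⟨hs, h 0 0⟩, ih hs.velocity fun k n => ?_, ih hs.spaceDeriv fun k n => h k (n + 1)⟩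
      rw [← hs.velocity_iterate_spaceDeriv]
      exact h (k + 1) n

lemma iteratedDeriv_iteratedDeriv_eq (f : ℝ → ℝ → ℝ) (k n : ℕ) :
    (fun t x => iteratedDeriv k (fun s => iteratedDeriv n (f s) x) t) =
      SquareRootRep.velocity^[k] (SquareRootRep.spaceDeriv^[n] f) := by
  have h1 : ∀ n f, (fun t x => iteratedDeriv n (f t) x) = SquareRootRep.spaceDeriv^[n] f := by
    intro n
    induction n with
    | zero => intro f; simp
    | succ n ih => intro f; simp only [iteratedDeriv_succ', Function.iterate_succ,
                      Function.comp, ← ih]; rfl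
  have h2 : ∀ n (f : ℝ → ℝ → ℝ), (fun t x => iteratedDeriv n (fun s => f s x) t) =
      SquareRootRep.velocity^[n] f := by
    intro n
    induction n with
    | zero => intro f; simp
    | succ n ih => intro f; simp only [iteratedDeriv_succ', Function.iterate_succ,
                      Function.comp, ← ih]; rfl
  rw [← h2, ← h1]

lemma mem_curves_iff {A : FunctionClass} : f ∈ curves A ↔ Controlled (LocallyControlled A) f := by
  rw [controlled_iff]
  simp only [curves, mem_ofPred_eq, iteratedDeriv_iteratedDeriv_eq]

/-- A bound on `f` which is uniform in space and locally uniform in time. -/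
def LocallyBounded (f : ℝ → ℝ → ℝ) : Prop :=
  ∀ T : ℝ, ∃ C : ℝ, ∀ t ∈ Icc (-T) T, ∀ x : ℝ, |f t x| ≤ C

/-- A growth condition which is stable under sums and under products with bounded functions. -/
structure IsControl (P : (ℝ → ℝ → ℝ) → Prop) : Prop where
  add : ∀ f g, Smooth₂ f → Smooth₂ g → P f → P g → P (f + g)
  dominated : ∀ f g, Smooth₂ f → Smooth₂ g → P f →
    (∀ T : ℝ, ∃ C : ℝ, ∀ t ∈ Icc (-T) T, ∀ x : ℝ, |g t x| ≤ C * |f t x|) → P g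

lemma IsControl.mul (hP : IsControl P) (hf : Smooth₂ f) (hg : Smooth₂ g) (h : P f)
    (hb : LocallyBounded g) : P (f * g) := by
  refine hP.dominated f _ hf (hf.mul hg) h fun T => ?_
  obtain ⟨C, hC⟩ := hb T
  refine ⟨C, fun t ht x => ?_⟩
  simp only [Pi.mul_apply, abs_mul, mul_comm C]
  exact mul_le_mul_of_nonneg_left (hC t ht x) (abs_nonneg _)

lemma ControlledTo.add (hP : IsControl P) (hf : ControlledTo P N f) (hg : ControlledTo P N g) :
    ControlledTo P N (f + g) := by
  induction N generalizing f g with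
  | zero => exact ⟨hf.1.add hg.1, hP.add f g hf.1 hg.1 hf.2 hg.2⟩
  | succ N ih =>
    refine ⟨⟨hf.1.1.add hg.1.1, hP.add f g hf.1.1 hg.1.1 hf.1.2 hg.1.2⟩, ?_, ?_⟩
    · rw [velocity_add hf.1.1 hg.1.1]; exact ih hf.2.1 hg.2.1
    · rw [spaceDeriv_add hf.1.1 hg.1.1]; exact ih hf.2.2 hg.2.2

/-- Leibniz rule by induction: only the first factor carries the decay, the second need only be
bounded. In each term one factor is differentiated and the other is kept at a lower order. -/
lemma ControlledTo.mul (hP : IsControl P) (hf : ControlledTo P N f)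
    (hg : ControlledTo LocallyBounded N g) : ControlledTo P N (f * g) := by
  induction N generalizing f g with
  | zero => exact ⟨hf.1.mul hg.1, hP.mul hf.1 hg.1 hf.2 hg.2⟩
  | succ N ih =>
    refine ⟨⟨hf.1.1.mul hg.1.1, hP.mul hf.1.1 hg.1.1 hf.1.2 hg.1.2⟩, ?_, ?_⟩
    · rw [velocity_mul hf.1.1 hg.1.1]
      exact (ih hf.2.1 hg.of_succ).add hP (ih hf.of_succ hg.2.1)
    · rw [spaceDeriv_mul hf.1.1 hg.1.1]
      exact (ih hf.2.2 hg.of_succ).add hP (ih hf.of_succ hg.2.2)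

lemma Controlled.add (hP : IsControl P) (hf : Controlled P f) (hg : Controlled P g) :
    Controlled P (f + g) := fun N => (hf N).add hP (hg N)

lemma Controlled.mul (hP : IsControl P) (hf : Controlled P f)
    (hg : Controlled LocallyBounded g) : Controlled P (f * g) := fun N => (hf N).mul hP (hg N)

lemma isControl_locallyBounded : IsControl LocallyBounded where
  add f g _ _ hf hg T := by
    obtain ⟨C, hC⟩ := hf T
    obtain ⟨D, hD⟩ := hg T
    exact ⟨C + D, fun t ht x => (abs_add_le _ _).trans (add_le_add (hC t ht x) (hD t ht x))⟩
  dominated f g _ _ hf h T := by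
    obtain ⟨C, hC⟩ := hf T
    obtain ⟨D, hD⟩ := h T
    refine ⟨|D| * C, fun t ht x => (hD t ht x).trans ?_⟩
    exact mul_le_mul (le_abs_self D) (hC t ht x) (abs_nonneg _) (abs_nonneg _)

lemma isControl_locallyControlled (A : FunctionClass) : IsControl (LocallyControlled A) := by
  cases A with
  | compactlySupported =>
    refine ⟨fun f g _ _ hf hg T => ?_, fun f g _ _ hf h T => ?_⟩
    · obtain ⟨C, hC⟩ := hf T
      obtain ⟨D, hD⟩ := hg T
      refine ⟨max C D, fun t ht x hx => ?_⟩
      simp [hC t ht x ((le_max_left _ _).trans_lt hx), hD t ht x ((le_max_right _ _).trans_lt hx)]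
    · obtain ⟨C, hC⟩ := hf T
      obtain ⟨D, hD⟩ := h T
      refine ⟨C, fun t ht x hx => ?_⟩
      have := hD t ht x
      rw [hC t ht x hx] at this
      simpa using this
  | schwartz =>
    refine ⟨fun f g _ _ hf hg T m => ?_, fun f g _ _ hf h T m => ?_⟩
    · obtain ⟨C, hC⟩ := hf T m
      obtain ⟨D, hD⟩ := hg T m
      refine ⟨C + D, fun t ht x => ?_⟩
      calc (1 + x ^ 2) ^ m * |f t x + g t x| ≤ (1 + x ^ 2) ^ m * (|f t x| + |g t x|) := by
            gcongr; exact abs_add_le _ _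
        _ ≤ C + D := by rw [mul_add]; exact add_le_add (hC t ht x) (hD t ht x)
    · obtain ⟨C, hC⟩ := hf T m
      obtain ⟨D, hD⟩ := h T
      refine ⟨|D| * C, fun t ht x => ?_⟩
      calc (1 + x ^ 2) ^ m * |g t x| ≤ (1 + x ^ 2) ^ m * (|D| * |f t x|) := by
            gcongr
            exact (hD t ht x).trans (by gcongr; exact le_abs_self D)
        _ = |D| * ((1 + x ^ 2) ^ m * |f t x|) := by ring
        _ ≤ |D| * C := by gcongr; exact hC t ht x
  | sobolevL1 =>
    refine ⟨fun f g _ _ hf hg T => ?_, fun f g hf hg hPf h T => ?_⟩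
    · obtain ⟨C, hC⟩ := hf T
      obtain ⟨D, hD⟩ := hg T
      refine ⟨C + D, fun t ht => ⟨(hC t ht).1.add (hD t ht).1, ?_⟩⟩
      calc ∫ x, |(f + g) t x| ≤ ∫ x, (|f t x| + |g t x|) :=
            integral_mono ((hC t ht).1.add (hD t ht).1).abs
              ((hC t ht).1.abs.add (hD t ht).1.abs) fun x => abs_add_le _ _
        _ = (∫ x, |f t x|) + ∫ x, |g t x| := integral_add (hC t ht).1.abs (hD t ht).1.abs
        _ ≤ C + D := add_le_add (hC t ht).2 (hD t ht).2
    · obtain ⟨C, hC⟩ := hPf T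
      obtain ⟨D, hD⟩ := h T
      have key : ∀ t ∈ Icc (-T) T, ∀ x, |g t x| ≤ |D| * |f t x| := fun t ht x =>
        (hD t ht x).trans (by gcongr; exact le_abs_self D)
      have hi : ∀ t ∈ Icc (-T) T, Integrable (g t) := fun t ht =>
        -- Domination alone does not make `g t` measurable; its smoothness does.
        ((hC t ht).1.abs.const_mul |D|).mono' (hg.comp_right t).continuous.aestronglyMeasurable
          (Eventually.of_forall (key t ht))
      refine ⟨|D| * C, fun t ht => ⟨hi t ht, ?_⟩⟩
      calc ∫ x, |g t x| ≤ ∫ x, |D| * |f t x| :=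
            integral_mono (hi t ht).abs ((hC t ht).1.abs.const_mul |D|) (key t ht)
        _ = |D| * ∫ x, |f t x| := integral_const_mul _ _
        _ ≤ |D| * C := by gcongr; exact (hC t ht).2

end Controlled

/-! ### Embedding into `W^{∞,1}`, uniform bounds and uniform gaps. -/

section Embeddings

variable {A : FunctionClass} {f g : ℝ → ℝ → ℝ}

/-- A compactly supported family is dominated by a constant on `[-r, r]`, a Schwartz family by a
multiple of `1/(1 + x²)`. Integral estimates then need to be proved for one class only. -/
lemma LocallyControlled.sobolevL1 (hs : Smooth₂ f) (hf : LocallyControlled A f) :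
    LocallyControlled .sobolevL1 f := by
  cases A with
  | sobolevL1 => exact hf
  | compactlySupported =>
    intro T
    obtain ⟨r, hr⟩ := hf T
    obtain ⟨C, hC⟩ := (isCompact_Icc (a := -T) (b := T)).prod (isCompact_Icc (a := -r) (b := r))
      |>.exists_bound_of_continuousOn hs.continuous.continuousOn
    have hi : Integrable (indicator (Icc (-r) r) fun _ : ℝ => C) :=
      (integrable_indicator_iff measurableSet_Icc).2 (by simp)
    have key : ∀ t ∈ Icc (-T) T, ∀ x, |f t x| ≤ indicator (Icc (-r) r) (fun _ : ℝ => C) x := by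
      intro t ht x
      by_cases hx : x ∈ Icc (-r) r
      · rw [indicator_of_mem hx]; exact hC (t, x) ⟨ht, hx⟩
      · rw [indicator_of_notMem hx, hr t ht x, abs_zero]
        by_contra! h
        exact hx (abs_le.1 h)
    have hi' : ∀ t ∈ Icc (-T) T, Integrable (f t) := fun t ht =>
      hi.mono' (hs.comp_right t).continuous.aestronglyMeasurable (Eventually.of_forall (key t ht))
    exact ⟨_, fun t ht => ⟨hi' t ht, integral_mono (hi' t ht).abs hi (key t ht)⟩⟩
  | schwartz =>
    intro T
    obtain ⟨C, hC⟩ := hf T 1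
    have hi : Integrable (fun x : ℝ => C * (1 + x ^ 2)⁻¹) := integrable_inv_one_add_sq.const_mul C
    have key : ∀ t ∈ Icc (-T) T, ∀ x, |f t x| ≤ C * (1 + x ^ 2)⁻¹ := by
      intro t ht x
      have := hC t ht x
      rw [← div_eq_mul_inv, le_div_iff₀ (by positivity)]
      linarith
    have hi' : ∀ t ∈ Icc (-T) T, Integrable (f t) := fun t ht =>
      hi.mono' (hs.comp_right t).continuous.aestronglyMeasurable (Eventually.of_forall (key t ht))
    exact ⟨_, fun t ht => ⟨hi' t ht, integral_mono (hi' t ht).abs hi (key t ht)⟩⟩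

lemma Controlled.sobolevL1 (hf : Controlled (LocallyControlled A) f) :
    Controlled (LocallyControlled .sobolevL1) f :=
  hf.imp fun _ h => LocallyControlled.sobolevL1 h.smooth h.prop

lemma LocallyControlled.integrable (hf : LocallyControlled .sobolevL1 f) (t : ℝ) :
    Integrable (f t) := by
  obtain ⟨C, hC⟩ := hf |t|
  exact (hC t (abs_le.1 le_rfl)).1

lemma Controlled.integrable (hf : Controlled (LocallyControlled A) f) (t : ℝ) :
    Integrable (f t) := hf.sobolevL1.prop.integrable t

lemma Controlled.tendsto_atBot (hf : Controlled (LocallyControlled A) f) (t : ℝ) :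
    Tendsto (f t) atBot (𝓝 0) :=
  tendsto_zero_of_hasDerivAt_of_integrableOn_Iic (a := 0)
    (fun x _ => hf.smooth.hasDerivAt_right t x)
    (hf.spaceDeriv.integrable t).integrableOn (hf.integrable t).integrableOn

lemma Controlled.tendsto_atTop (hf : Controlled (LocallyControlled A) f) (t : ℝ) :
    Tendsto (f t) atTop (𝓝 0) :=
  tendsto_zero_of_hasDerivAt_of_integrableOn_Ioi (a := 0)
    (fun x _ => hf.smooth.hasDerivAt_right t x)
    (hf.spaceDeriv.integrable t).integrableOn (hf.integrable t).integrableOn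

/-- The embedding `W^{1,1} ⊂ L^∞`: as `f` vanishes at `-∞`, it is the integral of `∂ₓ f`, so the
`L¹` bound on `∂ₓ f` bounds `f`. -/
lemma Controlled.locallyBounded (hf : Controlled (LocallyControlled A) f) :
    Controlled LocallyBounded f := by
  refine hf.imp fun f h T => ?_
  obtain ⟨C, hC⟩ := h.sobolevL1.spaceDeriv.prop T
  refine ⟨C, fun t ht x => ?_⟩
  have hi := h.spaceDeriv.integrable t
  have e := integral_Iic_of_hasDerivAt_of_tendsto' (a := x)
    (fun y _ => h.smooth.hasDerivAt_right t y) hi.integrableOn (h.tendsto_atBot t)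
  rw [sub_zero] at e
  rw [← e]
  calc |∫ y in Iic x, SquareRootRep.spaceDeriv f t y|
      ≤ ∫ y in Iic x, |SquareRootRep.spaceDeriv f t y| :=
        abs_integral_le_integral_abs
    _ ≤ ∫ y, |SquareRootRep.spaceDeriv f t y| :=
        setIntegral_le_integral hi.abs (Eventually.of_forall fun y => abs_nonneg _)
    _ ≤ C := (hC t ht).2

/-- Functions vanishing at infinity which are `> a` are bounded away from `a < 0`. -/
lemma Controlled.exists_lower_bound (hf : Controlled (LocallyControlled A) f) {a t : ℝ}
    (ha : a < 0) (h : ∀ x, a < f t x) : ∃ ε > 0, ∀ x, a + ε ≤ f t x := by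
  have hc : Tendsto (f t) (cocompact ℝ) (𝓝 0) := by
    rw [cocompact_eq_atBot_atTop]
    exact (hf.tendsto_atBot t).sup (hf.tendsto_atTop t)
  -- Outside a compact set `f > a / 2`, which leaves the gap `-a / 2`; on that set the minimum is
  -- attained and exceeds `a`.
  have hev := hc.eventually (lt_mem_nhds (show a / 2 < 0 by linarith))
  obtain ⟨K, hK, hKc⟩ := mem_cocompact.1 hev
  by_cases hne : K.Nonempty
  · obtain ⟨x₀, -, hx₀⟩ := hK.exists_isMinOn hne (hf.smooth.comp_right t).continuous.continuousOn
    refine ⟨min (f t x₀ - a) (-a / 2), lt_min (by linarith [h x₀]) (by linarith), fun x => ?_⟩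
    by_cases hx : x ∈ K
    · have : f t x₀ ≤ f t x := hx₀ hx
      linarith [min_le_left (f t x₀ - a) (-a / 2)]
    · have : a / 2 < f t x := hKc hx
      linarith [min_le_right (f t x₀ - a) (-a / 2)]
  · refine ⟨-a / 2, by linarith, fun x => ?_⟩
    have : a / 2 < f t x := hKc (fun hx => hne ⟨x, hx⟩)
    linarith

/-- Locally Lipschitz dependence on time, uniformly in space. -/
lemma Controlled.exists_lipschitz (hf : Controlled LocallyBounded f) (T : ℝ) :
    ∃ C > 0, ∀ s ∈ Icc (-T) T, ∀ t ∈ Icc (-T) T, ∀ x, |f t x - f s x| ≤ C * |t - s| := by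
  obtain ⟨C, hC⟩ := hf.velocity.prop T
  refine ⟨max C 1, by positivity, fun s hs t ht x => ?_⟩
  exact (convex_Icc (-T) T).norm_image_sub_le_of_norm_hasDerivWithin_le
    (fun u _ => (hf.smooth.hasDerivAt_left u x).hasDerivWithinAt)
    (fun u hu => (hC u hu x).trans (le_max_left _ _)) hs ht

lemma Controlled.eventually_lower_bound (hf : Controlled (LocallyControlled A) f) {a t : ℝ}
    (ha : a < 0) (h : ∀ x, a < f t x) : ∃ ε > 0, ∀ᶠ s in 𝓝 t, ∀ x, a + ε ≤ f s x := by
  obtain ⟨ε, hε, hb⟩ := hf.exists_lower_bound ha h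
  obtain ⟨C, hC, hL⟩ := hf.locallyBounded.exists_lipschitz (|t| + 1)
  refine ⟨ε / 2, by positivity, ?_⟩
  -- Radius `1` keeps `s` in the window where `C` is valid; radius `ε / (2C)` spends at most half of
  -- the gap.
  filter_upwards [Metric.ball_mem_nhds t (show 0 < min 1 (ε / (2 * C)) by positivity)] with s hs x
  rw [Metric.mem_ball, Real.dist_eq, lt_min_iff] at hs
  have h1 : |s| ≤ |t| + 1 := by
    have := abs_add_le t (s - t)
    rw [add_sub_cancel] at this
    linarith
  have h2 := hL t (abs_le.1 (by linarith)) s (abs_le.1 h1) x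
  have h3 : C * |s - t| ≤ ε / 2 := by
    have := mul_le_mul_of_nonneg_left hs.2.le hC.le
    calc _ ≤ _ := this
      _ = ε / 2 := by field_simp
  have h4 := (abs_le.1 h2).1
  linarith [hb x]

/-- `f > a`, with a gap that is uniform in space and locally uniform in time. -/
def LocallyBoundedBelow (a : ℝ) (f : ℝ → ℝ → ℝ) : Prop :=
  ∀ T : ℝ, ∃ ε > 0, ∀ t ∈ Icc (-T) T, ∀ x, a + ε ≤ f t x

lemma LocallyBoundedBelow.lt {a : ℝ} (h : LocallyBoundedBelow a f) (t x : ℝ) : a < f t x := by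
  obtain ⟨ε, hε, hb⟩ := h |t|
  linarith [hb t (abs_le.1 le_rfl) x]

/-- Having a gap is a local property in time and passes to finite unions, so compactness of `[-T,
T]` makes it uniform. -/
lemma Controlled.locallyBoundedBelow (hf : Controlled (LocallyControlled A) f) {a : ℝ}
    (ha : a < 0) (h : ∀ t x, a < f t x) : LocallyBoundedBelow a f := by
  intro T
  refine (isCompact_Icc (a := -T) (b := T)).induction_on
    (p := fun s => ∃ ε > 0, ∀ t ∈ s, ∀ x, a + ε ≤ f t x) ⟨1, one_pos, by simp⟩ ?_ ?_ ?_
  · rintro s u hsu ⟨ε, hε, hb⟩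
    exact ⟨ε, hε, fun t ht => hb t (hsu ht)⟩
  · rintro s u ⟨ε, hε, hb⟩ ⟨δ, hδ, hd⟩
    refine ⟨min ε δ, lt_min hε hδ, fun t ht x => ?_⟩
    rcases ht with ht | ht
    · linarith [hb t ht x, min_le_left ε δ]
    · linarith [hd t ht x, min_le_right ε δ]
  · intro t _
    obtain ⟨ε, hε, hb⟩ := hf.eventually_lower_bound ha (h t)
    exact ⟨_, mem_nhdsWithin_of_mem_nhds hb, ε, hε, fun s hs => hs⟩

end Embeddings

/-! ### Superposition with smooth functions on a half-line. -/

section Composition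

variable {A : FunctionClass} {f : ℝ → ℝ → ℝ} {Φ : ℝ → ℝ} {a : ℝ}

lemma Smooth₂.comp_outer (hΦ : ContDiffOn ℝ ∞ Φ (Ioi a)) (hf : Smooth₂ f)
    (hb : ∀ t x, a < f t x) : Smooth₂ (fun t x => Φ (f t x)) :=
  hΦ.comp_contDiff hf fun p => hb p.1 p.2

lemma hasDerivAt_of_contDiffOn_Ioi (hΦ : ContDiffOn ℝ ∞ Φ (Ioi a)) {y : ℝ} (hy : a < y) :
    HasDerivAt Φ (deriv Φ y) y :=
  ((hΦ.differentiableOn (by simp)).differentiableAt (Ioi_mem_nhds hy)).hasDerivAt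

lemma velocity_comp_outer (hΦ : ContDiffOn ℝ ∞ Φ (Ioi a)) (hf : Smooth₂ f)
    (hb : ∀ t x, a < f t x) :
    velocity (fun t x => Φ (f t x)) = velocity f * fun t x => deriv Φ (f t x) := by
  ext t x
  have := (hasDerivAt_of_contDiffOn_Ioi hΦ (hb t x)).comp t (hf.hasDerivAt_left t x)
  exact this.deriv.trans (mul_comm _ _)

lemma spaceDeriv_comp_outer (hΦ : ContDiffOn ℝ ∞ Φ (Ioi a)) (hf : Smooth₂ f)
    (hb : ∀ t x, a < f t x) :
    spaceDeriv (fun t x => Φ (f t x)) = spaceDeriv f * fun t x => deriv Φ (f t x) := by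
  ext t x
  have := (hasDerivAt_of_contDiffOn_Ioi hΦ (hb t x)).comp x (hf.hasDerivAt_right t x)
  exact this.deriv.trans (mul_comm _ _)

/-- The function `Φ` may blow up at `a`; the gap confines the values of `f` to a compact interval
inside `(a, ∞)`. -/
lemma LocallyBounded.comp_outer (hΦ : ContinuousOn Φ (Ioi a)) (hf : LocallyBounded f)
    (hb : LocallyBoundedBelow a f) : LocallyBounded (fun t x => Φ (f t x)) := by
  intro T
  obtain ⟨ε, hε, hb⟩ := hb T
  obtain ⟨C, hC⟩ := hf T
  obtain ⟨D, hD⟩ := (isCompact_Icc (a := a + ε) (b := C)).exists_bound_of_continuousOn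
    (hΦ.mono fun y hy => lt_of_lt_of_le (by linarith) hy.1)
  exact ⟨D, fun t ht x => hD _ ⟨hb t ht x, (abs_le.1 (hC t ht x)).2⟩⟩

/-- Superposition with a smooth function preserves boundedness of all derivatives. -/
lemma Controlled.comp_outer (hΦ : ContDiffOn ℝ ∞ Φ (Ioi a)) (hf : Controlled LocallyBounded f)
    (hb : LocallyBoundedBelow a f) : Controlled LocallyBounded (fun t x => Φ (f t x)) := by
  intro N
  -- The chain rule replaces `Φ` by its derivative, hence the generalization.
  induction N generalizing Φ with
  | zero => exact ⟨hf.smooth.comp_outer hΦ hb.lt, hf.prop.comp_outer hΦ.continuousOn hb⟩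
  | succ N ih =>
    have hΦ' : ContDiffOn ℝ ∞ (deriv Φ) (Ioi a) := hΦ.deriv_of_isOpen isOpen_Ioi (by simp)
    refine ⟨⟨hf.smooth.comp_outer hΦ hb.lt, hf.prop.comp_outer hΦ.continuousOn hb⟩, ?_, ?_⟩
    · rw [velocity_comp_outer hΦ hf.smooth hb.lt]
      exact (hf.velocity N).mul isControl_locallyBounded (ih hΦ')
    · rw [spaceDeriv_comp_outer hΦ hf.smooth hb.lt]
      exact (hf.spaceDeriv N).mul isControl_locallyBounded (ih hΦ')

/-- Superposition with a smooth function fixing zero preserves the class of smooth curves. -/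
lemma Controlled.comp_outer_zero (hΦ : ContDiffOn ℝ ∞ Φ (Ioi a)) (h0 : Φ 0 = 0) (ha : a < 0)
    (hf : Controlled (LocallyControlled A) f) (hb : LocallyBoundedBelow a f) :
    Controlled (LocallyControlled A) (fun t x => Φ (f t x)) := by
  have hΦ' : ContDiffOn ℝ ∞ (deriv Φ) (Ioi a) := hΦ.deriv_of_isOpen isOpen_Ioi (by simp)
  have hA := isControl_locallyControlled A
  have hs := hf.smooth.comp_outer hΦ hb.lt
  refine Controlled.of_partials hs ?_ ?_ ?_
  · refine hA.dominated f _ hf.smooth hs hf.prop fun T => ?_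
    obtain ⟨ε, hε, hb⟩ := hb T
    obtain ⟨C, hC⟩ := hf.locallyBounded.prop T
    -- Taking `δ ≤ -a` and the right end `|C|` puts `0` in the interval, so the mean value
    -- inequality from `Φ 0 = 0` gives `|Φ(f)| ≤ D |f|`.
    set δ := min ε (-a) with hδ
    have hδ0 : 0 < δ := lt_min hε (by linarith)
    have hsub : Icc (a + δ) |C| ⊆ Ioi a := fun y hy => lt_of_lt_of_le (by linarith) hy.1
    obtain ⟨D, hD⟩ := (isCompact_Icc (a := a + δ) (b := |C|)).exists_bound_of_continuousOn
      (hΦ'.continuousOn.mono hsub)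
    refine ⟨D, fun t ht x => ?_⟩
    have := (convex_Icc (a + δ) |C|).norm_image_sub_le_of_norm_hasDerivWithin_le
      (fun u hu => (hasDerivAt_of_contDiffOn_Ioi hΦ (hsub hu)).hasDerivWithinAt) hD
      (x := 0) (y := f t x) ⟨by linarith [min_le_right ε (-a)], abs_nonneg _⟩
      ⟨by linarith [hb t ht x, min_le_left ε (-a)],
        ((abs_le.1 (hC t ht x)).2).trans (le_abs_self C)⟩
    simpa [h0] using this
  -- The decay comes from `∂ₜ f`; the factor `Φ'(f)` is merely bounded, since `Φ'(0)` need not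
  -- vanish.
  · rw [velocity_comp_outer hΦ hf.smooth hb.lt]
    exact hf.velocity.mul hA (hf.locallyBounded.comp_outer hΦ' hb)
  · rw [spaceDeriv_comp_outer hΦ hf.smooth hb.lt]
    exact hf.spaceDeriv.mul hA (hf.locallyBounded.comp_outer hΦ' hb)

end Composition

/-! ### Time-dependent multipliers and products. -/

section Elementary

variable {A : FunctionClass} {P : (ℝ → ℝ → ℝ) → Prop} {f g : ℝ → ℝ → ℝ}

/-- Admits constants and cut-offs in time as multipliers, although they do not decay in space. -/
lemma Controlled.of_time {s : ℝ → ℝ} (hs : ContDiff ℝ ∞ s) :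
    Controlled LocallyBounded (fun t _ => s t) := by
  rw [controlled_iff]
  have hsm : Smooth₂ (fun t _ => s t) := hs.comp contDiff_fst
  refine ⟨hsm, fun k n => ?_⟩
  have hb : ∀ s : ℝ → ℝ, ContDiff ℝ ∞ s → ∀ k,
      LocallyBounded (SquareRootRep.velocity^[k] (fun t _ => s t)) := by
    intro s hs k
    induction k generalizing s with
    | zero =>
      intro T
      obtain ⟨C, hC⟩ := (isCompact_Icc (a := -T) (b := T)).exists_bound_of_continuousOn
        hs.continuous.continuousOn
      exact ⟨C, fun t ht _ => hC t ht⟩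
    | succ k ih =>
      exact ih (deriv s) ((contDiff_infty_iff_deriv.1 hs).2)
  have hn : ∀ n, ∃ r : ℝ → ℝ, ContDiff ℝ ∞ r ∧
      SquareRootRep.spaceDeriv^[n] (fun t _ => s t) = fun t _ => r t := by
    intro n
    induction n with
    | zero => exact ⟨s, hs, rfl⟩
    | succ n ih =>
      obtain ⟨r, -, he⟩ := ih
      refine ⟨fun _ => 0, contDiff_const, ?_⟩
      rw [Function.iterate_succ_apply', he]
      ext t x
      exact deriv_const x (r t)
  obtain ⟨r, hr, he⟩ := hn n
  rw [he]
  exact hb r hr k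

lemma Controlled.const_mul (hP : IsControl P) (hf : Controlled P f) (a : ℝ) :
    Controlled P (fun t x => a * f t x) := by
  have := hf.mul hP (Controlled.of_time (contDiff_const (c := a)))
  convert this using 3
  exact mul_comm _ _

lemma Controlled.mul_self (hf : Controlled (LocallyControlled A) f)
    (hg : Controlled (LocallyControlled A) g) : Controlled (LocallyControlled A) (f * g) :=
  hf.mul (isControl_locallyControlled A) hg.locallyBounded

end Elementary

/-! ### Elements of `𝒜(ℝ)` as constant curves. -/

section Static

variable {A : FunctionClass} {f g : ℝ → ℝ}

lemma smooth₂_const (hf : ContDiff ℝ ∞ f) : Smooth₂ (fun _ => f) := hf.comp contDiff_snd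

/-- All time derivatives of a constant curve vanish, which is why `P 0` is required. -/
lemma controlled_const_iff {P : (ℝ → ℝ → ℝ) → Prop} (h0 : P 0) :
    Controlled P (fun _ => f) ↔ ContDiff ℝ ∞ f ∧ ∀ n, P (fun _ => iteratedDeriv n f) := by
  have h1 : ∀ n, SquareRootRep.spaceDeriv^[n] (fun _ => f) = fun _ => iteratedDeriv n f := by
    intro n
    rw [← Function.iterate_zero_apply SquareRootRep.velocity
      (SquareRootRep.spaceDeriv^[n] (fun _ => f)), ← iteratedDeriv_iteratedDeriv_eq]
    simp
  have hz : ∀ k, SquareRootRep.velocity^[k] (0 : ℝ → ℝ → ℝ) = 0 := by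
    intro k
    induction k with
    | zero => rfl
    | succ k ih =>
      rw [Function.iterate_succ_apply', ih]
      ext t x
      exact deriv_const t (0 : ℝ)
  rw [controlled_iff]
  constructor
  · rintro ⟨hs, h⟩
    refine ⟨hs.comp_right 0, fun n => ?_⟩
    rw [← h1]; exact h 0 n
  · rintro ⟨hf, h⟩
    refine ⟨smooth₂_const hf, fun k n => ?_⟩
    rw [h1]
    cases k with
    | zero => exact h n
    | succ k =>
      have : SquareRootRep.velocity (fun _ => iteratedDeriv n f) = 0 := by
        ext t x; exact deriv_const t (iteratedDeriv n f x)
      rw [Function.iterate_succ_apply, this, hz]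
      exact h0

lemma locallyControlled_zero (A : FunctionClass) : LocallyControlled A 0 := by
  cases A
  · exact fun T => ⟨0, by simp⟩
  · exact fun T m => ⟨0, by simp⟩
  · exact fun T => ⟨0, fun t _ => ⟨integrable_zero _ _ _, by simp⟩⟩

lemma mem_space_iff_iteratedDeriv :
    f ∈ space A ↔ ContDiff ℝ ∞ f ∧ ∀ n, LocallyControlled A (fun _ => iteratedDeriv n f) := by
  cases A with
  | compactlySupported =>
    constructor
    · rintro ⟨hf, hc⟩
      refine ⟨hf, fun n T => ?_⟩
      have hcn : HasCompactSupport (iteratedDeriv n f) := by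
        induction n with
        | zero => simpa using hc
        | succ n ih => rw [iteratedDeriv_succ]; exact ih.deriv
      obtain ⟨r, hr⟩ := hcn.isBounded.subset_closedBall 0
      refine ⟨r, fun _ _ x hx => ?_⟩
      by_contra h
      have := hr (subset_tsupport _ h)
      rw [mem_closedBall_zero_iff, Real.norm_eq_abs] at this
      linarith
    · rintro ⟨hf, h⟩
      refine ⟨hf, ?_⟩
      obtain ⟨r, hr⟩ := h 0 1
      refine HasCompactSupport.intro (isCompact_Icc (a := -r) (b := r)) fun x hx => ?_
      have := hr 0 (by simp) x (by
        by_contra! h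
        exact hx (abs_le.1 h))
      simpa using this
  | schwartz =>
    constructor
    · rintro ⟨f, rfl⟩
      refine ⟨f.smooth _, fun n T m => ?_⟩
      obtain ⟨C, hC⟩ := f.decay (2 * m) n
      obtain ⟨D, hD⟩ := f.decay 0 n
      refine ⟨2 ^ m * (D + C), fun _ _ x => ?_⟩
      have hC := hC.2 x
      have hD := hD.2 x
      rw [norm_iteratedFDeriv_eq_norm_iteratedDeriv, Real.norm_eq_abs, Real.norm_eq_abs] at hC hD
      -- Compares the weight `(1 + x²)^m` with the monomial weights in the Schwartz seminorms.
      have h1 : (1 + x ^ 2) ^ m ≤ 2 ^ m * (1 + |x| ^ (2 * m)) := by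
        rw [pow_mul, sq_abs]
        calc (1 + x ^ 2) ^ m ≤ (2 * max 1 (x ^ 2)) ^ m := by
              gcongr
              linarith [le_max_left 1 (x ^ 2), le_max_right 1 (x ^ 2)]
          _ = 2 ^ m * (max 1 (x ^ 2)) ^ m := mul_pow _ _ _
          _ ≤ 2 ^ m * (1 + (x ^ 2) ^ m) := by
              gcongr
              rcases max_cases 1 (x ^ 2) with h | h
              · rw [h.1, one_pow]; linarith [pow_nonneg (sq_nonneg x) m]
              · rw [h.1]; linarith
      calc (1 + x ^ 2) ^ m * |iteratedDeriv n f x|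
          ≤ 2 ^ m * (1 + |x| ^ (2 * m)) * |iteratedDeriv n f x| := by gcongr
        _ = 2 ^ m * (|x| ^ 0 * |iteratedDeriv n f x| + |x| ^ (2 * m) * |iteratedDeriv n f x|) := by
            ring
        _ ≤ 2 ^ m * (D + C) := by gcongr
    · rintro ⟨hf, h⟩
      refine ⟨⟨f, hf, fun k n => ?_⟩, rfl⟩
      obtain ⟨C, hC⟩ := h n 0 k
      refine ⟨C, fun x => ?_⟩
      rw [norm_iteratedFDeriv_eq_norm_iteratedDeriv, Real.norm_eq_abs, Real.norm_eq_abs]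
      refine le_trans ?_ (hC 0 (by simp) x)
      gcongr
      -- This is `|x| ≤ 1 + x²`.
      nlinarith [sq_abs x, sq_nonneg (|x| - 1), abs_nonneg x]
  | sobolevL1 =>
    constructor
    · rintro ⟨hf, h⟩
      exact ⟨hf, fun n T => ⟨_, fun _ _ => ⟨h n, le_rfl⟩⟩⟩
    · rintro ⟨hf, h⟩
      exact ⟨hf, fun n => (h n).integrable 0⟩

/-- Lets every result on curves be applied to single functions. -/
lemma mem_space_iff : f ∈ space A ↔ Controlled (LocallyControlled A) (fun _ => f) := by
  rw [mem_space_iff_iteratedDeriv, controlled_const_iff (locallyControlled_zero A)]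

lemma LocallyControlled.freeze {f : ℝ → ℝ → ℝ} (hf : LocallyControlled A f) (t : ℝ) :
    LocallyControlled A (fun _ => f t) := by
  have ht : t ∈ Icc (-|t|) |t| := abs_le.1 le_rfl
  cases A
  · exact fun _ => (hf |t|).imp fun r hr _ _ => hr t ht
  · exact fun _ m => (hf |t| m).imp fun r hr _ _ => hr t ht
  · exact fun _ => (hf |t|).imp fun r hr _ _ => hr t ht

lemma Controlled.mem_space {f : ℝ → ℝ → ℝ} (hf : Controlled (LocallyControlled A) f) (t : ℝ) :
    f t ∈ space A := by
  rw [mem_space_iff_iteratedDeriv]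
  refine ⟨hf.smooth.comp_right t, fun n => ?_⟩
  have h := (controlled_iff.1 hf).2 0 n
  rw [← iteratedDeriv_iteratedDeriv_eq] at h
  simpa using h.freeze t

end Static

/-! ### Integrals depending on time -/

section Integrals

variable {A : FunctionClass} {f : ℝ → ℝ → ℝ}

lemma Controlled.exists_setIntegral_bound (hf : Controlled (LocallyControlled A) f) (T : ℝ) :
    ∃ C, ∀ t ∈ Icc (-T) T, ∀ S : Set ℝ, ∫ y in S, |f t y| ≤ C := by
  obtain ⟨C, hC⟩ := hf.sobolevL1.prop T
  exact ⟨C, fun t ht S => (setIntegral_le_integral (hC t ht).1.abs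
    (Eventually.of_forall fun y => abs_nonneg _)).trans (hC t ht).2⟩

/-- Fundamental theorem of calculus in `t` followed by Fubini. The control provides norm bounds
rather than a pointwise majorant; a uniform `L¹` bound on `∂ₜ f` is what integrability on the
product needs. -/
lemma Controlled.setIntegral_sub (hf : Controlled (LocallyControlled A) f) (S : Set ℝ)
    (s t : ℝ) : (∫ y in S, f t y) - ∫ y in S, f s y =
      ∫ τ in s..t, ∫ y in S, SquareRootRep.velocity f τ y := by
  have hv := hf.velocity
  have hcont : Continuous (Function.uncurry (SquareRootRep.velocity f)) := hv.smooth.continuous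
  obtain ⟨C, hC⟩ := hv.exists_setIntegral_bound (max |s| |t|)
  have hmem : ∀ τ ∈ uIoc s t, τ ∈ Icc (-max |s| |t|) (max |s| |t|) := by
    intro τ hτ
    have h1 := abs_le.1 (le_max_left |s| |t|)
    have h2 := abs_le.1 (le_max_right |s| |t|)
    rcases mem_uIoc.1 hτ with h | h
    · exact ⟨h1.1.trans h.1.le, h.2.trans h2.2⟩
    · exact ⟨h2.1.trans h.1.le, h.2.trans h1.2⟩
  have hint : Integrable (Function.uncurry (SquareRootRep.velocity f))
      ((volume.restrict (uIoc s t)).prod (volume.restrict S)) := by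
    rw [integrable_prod_iff hcont.aestronglyMeasurable]
    refine ⟨Eventually.of_forall fun τ => (hv.integrable τ).integrableOn, ?_⟩
    refine Measure.integrableOn_of_bounded (M := C) (by simp [uIoc]) ?_ ?_
    · exact hcont.aestronglyMeasurable.norm.integral_prod_right'
    · filter_upwards [ae_restrict_mem measurableSet_uIoc] with τ hτ
      rw [Real.norm_eq_abs, abs_of_nonneg (integral_nonneg fun y => norm_nonneg _)]
      exact hC τ (hmem τ hτ) S
  rw [intervalIntegral_integral_swap hint,
    ← integral_sub (hf.integrable t).integrableOn (hf.integrable s).integrableOn]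
  congr 1
  ext y
  refine (intervalIntegral.integral_eq_sub_of_hasDerivAt
    (fun τ _ => hf.smooth.hasDerivAt_left τ y) ?_).symm
  exact (hv.smooth.comp_left y).continuous.intervalIntegrable _ _

/-- The constant does not depend on `S`; with `S = Iic x` this gives equicontinuity in time of the
antiderivatives. -/
lemma Controlled.exists_setIntegral_lipschitz (hf : Controlled (LocallyControlled A) f) (T : ℝ) :
    ∃ C > 0, ∀ s ∈ Icc (-T) T, ∀ t ∈ Icc (-T) T, ∀ S : Set ℝ,
      |(∫ y in S, f t y) - ∫ y in S, f s y| ≤ C * |t - s| := by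
  obtain ⟨C, hC⟩ := hf.velocity.exists_setIntegral_bound T
  refine ⟨max C 1, by positivity, fun s hs t ht S => ?_⟩
  rw [hf.setIntegral_sub, ← Real.norm_eq_abs]
  refine intervalIntegral.norm_integral_le_of_norm_le_const fun τ hτ => ?_
  have hτ' : τ ∈ Icc (-T) T := by
    rcases mem_uIoc.1 hτ with h | h
    · exact ⟨hs.1.trans h.1.le, h.2.trans ht.2⟩
    · exact ⟨ht.1.trans h.1.le, h.2.trans hs.2⟩
  exact (norm_integral_le_integral_norm _).trans ((hC τ hτ' S).trans (le_max_left _ _))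

lemma Controlled.continuous_setIntegral (hf : Controlled (LocallyControlled A) f) (S : Set ℝ) :
    Continuous (fun t => ∫ y in S, f t y) := by
  rw [continuous_iff_continuousAt]
  intro t
  obtain ⟨C, hC, h⟩ := hf.exists_setIntegral_lipschitz (|t| + 1)
  rw [ContinuousAt, tendsto_iff_norm_sub_tendsto_zero]
  have hlim : Tendsto (fun s => C * |s - t|) (𝓝 t) (𝓝 0) := by
    have : Continuous (fun s => C * |s - t|) := by fun_prop
    simpa using this.tendsto t
  refine tendsto_of_tendsto_of_tendsto_of_le_of_le' tendsto_const_nhds hlim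
    (Eventually.of_forall fun s => norm_nonneg _) ?_
  filter_upwards [Metric.ball_mem_nhds t one_pos] with s hs
  rw [Metric.mem_ball, Real.dist_eq] at hs
  refine h t (abs_le.1 (by linarith)) s (abs_le.1 ?_) S
  have := abs_add_le t (s - t)
  rw [add_sub_cancel] at this
  linarith

/-- By `setIntegral_sub` the integral is a primitive in time of a continuous function. -/
lemma Controlled.hasDerivAt_setIntegral (hf : Controlled (LocallyControlled A) f) (S : Set ℝ)
    (t : ℝ) : HasDerivAt (fun t => ∫ y in S, f t y)
      (∫ y in S, SquareRootRep.velocity f t y) t := by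
  have hc := hf.velocity.continuous_setIntegral S
  have h := intervalIntegral.integral_hasDerivAt_right (hc.intervalIntegrable 0 t)
    hc.stronglyMeasurable.stronglyMeasurableAtFilter hc.continuousAt
  have e : (fun t => ∫ y in S, f t y) = fun t => (∫ y in S, f 0 y) +
      ∫ τ in (0)..t, ∫ y in S, SquareRootRep.velocity f τ y := by
    ext t
    rw [← hf.setIntegral_sub S 0 t]
    ring
  rw [e]
  exact h.const_add _

lemma Controlled.hasDerivAt_integral (hf : Controlled (LocallyControlled A) f) (t : ℝ) :
    HasDerivAt (fun t => ∫ y, f t y) (∫ y, SquareRootRep.velocity f t y) t := by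
  simpa using hf.hasDerivAt_setIntegral univ t

lemma Controlled.contDiff_integral (hf : Controlled (LocallyControlled A) f) :
    ContDiff ℝ ∞ (fun t => ∫ y, f t y) := by
  rw [contDiff_infty]
  intro n
  induction n generalizing f with
  | zero =>
    rw [Nat.cast_zero, contDiff_zero]
    exact continuous_iff_continuousAt.2 fun t => (hf.hasDerivAt_integral t).continuousAt
  | succ n ih =>
    rw [Nat.cast_succ, contDiff_succ_iff_deriv]
    refine ⟨fun t => (hf.hasDerivAt_integral t).differentiableAt, by simp, ?_⟩
    rw [funext fun t => (hf.hasDerivAt_integral t).deriv]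
    exact ih hf.velocity

/-- The antiderivative in the space variable which vanishes at `-∞`. -/
def antideriv (f : ℝ → ℝ → ℝ) : ℝ → ℝ → ℝ := fun t x => ∫ y in Iic x, f t y

lemma hasDerivAt_integral_Iic {f : ℝ → ℝ} (hc : Continuous f) (hi : Integrable f) (x : ℝ) :
    HasDerivAt (fun x => ∫ y in Iic x, f y) (f x) x := by
  have h := intervalIntegral.integral_hasDerivAt_right (hc.intervalIntegrable 0 x)
    hc.stronglyMeasurable.stronglyMeasurableAtFilter hc.continuousAt
  have e : (fun x => ∫ y in Iic x, f y) = fun x => (∫ y in Iic 0, f y) +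
      ∫ y in (0)..x, f y := by
    ext x
    rw [← intervalIntegral.integral_Iic_sub_Iic hi.integrableOn hi.integrableOn]
    ring
  rw [e]
  exact h.const_add _

lemma Controlled.hasDerivAt_antideriv (hf : Controlled (LocallyControlled A) f) (t x : ℝ) :
    HasDerivAt (antideriv f t) (f t x) x :=
  hasDerivAt_integral_Iic (hf.smooth.comp_right t).continuous (hf.integrable t) x

lemma Controlled.spaceDeriv_antideriv (hf : Controlled (LocallyControlled A) f) :
    SquareRootRep.spaceDeriv (antideriv f) = f := by
  ext t x; exact (hf.hasDerivAt_antideriv t x).deriv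

lemma Controlled.velocity_antideriv (hf : Controlled (LocallyControlled A) f) :
    SquareRootRep.velocity (antideriv f) = antideriv (SquareRootRep.velocity f) := by
  ext t x; exact (hf.hasDerivAt_setIntegral (Iic x) t).deriv

/-- The increment splits into a change of time, Lipschitz uniformly in `x`, and a change of `x` at
fixed time. -/
lemma Controlled.continuous_antideriv (hf : Controlled (LocallyControlled A) f) :
    Continuous (Function.uncurry (antideriv f)) := by
  rw [continuous_iff_continuousAt]
  rintro ⟨t, x⟩
  obtain ⟨C, hC, h⟩ := hf.exists_setIntegral_lipschitz (|t| + 1)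
  have h1 : Tendsto (fun p : ℝ × ℝ => antideriv f p.1 p.2 - antideriv f t p.2)
      (𝓝 (t, x)) (𝓝 0) := by
    have hlim : Tendsto (fun p : ℝ × ℝ => C * |p.1 - t|) (𝓝 (t, x)) (𝓝 0) := by
      have : Continuous (fun p : ℝ × ℝ => C * |p.1 - t|) := by fun_prop
      simpa using this.tendsto (t, x)
    refine squeeze_zero_norm' ?_ hlim
    have hb : ∀ᶠ p : ℝ × ℝ in 𝓝 (t, x), p.1 ∈ Metric.ball t 1 :=
      continuous_fst.continuousAt.eventually_mem (Metric.ball_mem_nhds t one_pos)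
    filter_upwards [hb] with p hp
    rw [Metric.mem_ball, Real.dist_eq] at hp
    refine h t (abs_le.1 (by linarith)) p.1 (abs_le.1 ?_) (Iic p.2)
    have := abs_add_le t (p.1 - t)
    rw [add_sub_cancel] at this
    linarith
  have h2 : Tendsto (fun p : ℝ × ℝ => antideriv f t p.2) (𝓝 (t, x)) (𝓝 (antideriv f t x)) :=
    (hf.hasDerivAt_antideriv t x).continuousAt.tendsto.comp continuous_snd.continuousAt
  have h3 := h1.add h2
  simp only [sub_add_cancel, zero_add] at h3
  exact h3

lemma Controlled.hasFDerivAt_antideriv (hf : Controlled (LocallyControlled A) f) (p : ℝ × ℝ) :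
    HasFDerivAt (Function.uncurry (antideriv f))
      ((ContinuousLinearMap.toSpanSingleton ℝ
          (antideriv (SquareRootRep.velocity f) p.1 p.2)).coprod
        (ContinuousLinearMap.toSpanSingleton ℝ (f p.1 p.2))) p := by
  have hL : Continuous (fun c : ℝ => ContinuousLinearMap.toSpanSingleton ℝ c) :=
    (ContinuousLinearMap.toSpanSingletonLE ℝ ℝ ℝ).toLinearMap.continuous_of_finiteDimensional
  refine (hasStrictFDerivAt_uncurry_coprod (f := antideriv f) (u := p)
    (f₁ := fun t x => ContinuousLinearMap.toSpanSingleton ℝ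
      (antideriv (SquareRootRep.velocity f) t x))
    (f₂ := fun t x => ContinuousLinearMap.toSpanSingleton ℝ (f t x)) ?_ ?_ ?_ ?_).hasFDerivAt
  · exact Eventually.of_forall fun v =>
      (hf.hasDerivAt_setIntegral (Iic v.2) v.1).hasFDerivAt
  · exact Eventually.of_forall fun v => (hf.hasDerivAt_antideriv v.1 v.2).hasFDerivAt
  · exact (hL.comp hf.velocity.continuous_antideriv).continuousAt
  · exact (hL.comp hf.smooth.continuous).continuousAt

/-- The partial derivatives are `antideriv (∂ₜ f)`, of the same type, and `f`, already smooth; so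
the induction gains one order at each step. -/
lemma Controlled.smooth_antideriv (hf : Controlled (LocallyControlled A) f) :
    Smooth₂ (antideriv f) := by
  rw [Smooth₂, contDiff_infty]
  intro n
  induction n generalizing f with
  | zero => rw [Nat.cast_zero, contDiff_zero]; exact hf.continuous_antideriv
  | succ n ih =>
    rw [Nat.cast_succ, contDiff_succ_iff_hasFDerivAt]
    refine ⟨_, ?_, hf.hasFDerivAt_antideriv⟩
    rw [contDiff_clm_apply_iff]
    rintro ⟨a, b⟩
    simp only [ContinuousLinearMap.coprod_apply, ContinuousLinearMap.toSpanSingleton_apply,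
      smul_eq_mul]
    exact (contDiff_const.mul (ih hf.velocity)).add
      (contDiff_const.mul (hf.smooth.of_le (mod_cast le_top)))

lemma Controlled.antideriv_mem_curves₁ (hf : Controlled (LocallyControlled A) f) :
    antideriv f ∈ curves₁ A := by
  refine ⟨hf.smooth_antideriv, ?_, fun t => tendsto_integral_Iic_zero tendsto_id⟩
  rw [mem_curves_iff]
  change Controlled _ (SquareRootRep.spaceDeriv (antideriv f))
  rwa [hf.spaceDeriv_antideriv]

end Integrals

/-! ### Changes of variable -/

section Diffeomorphisms

/-- A diffeomorphism `ψ` of the line at bounded distance from the identity, whose derivative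
`u ∘ ψ` is bounded together with all derivatives of `u`, and bounded away from zero. -/
structure IsTameDiffeo (ψ u : ℝ → ℝ) : Prop where
  bijective : Function.Bijective ψ
  hasDerivAt : ∀ x, HasDerivAt ψ (u (ψ x)) x
  controlled : Controlled LocallyBounded (fun _ => u)
  pos : ∃ δ > 0, ∀ y, δ ≤ u y
  close : ∃ C, ∀ x, |ψ x - x| ≤ C

variable {ψ u χ : ℝ → ℝ} {A : FunctionClass}

lemma integral_comp_mul_deriv_of_bijective {v : ℝ → ℝ} (hψ : Function.Bijective ψ)
    (hd : ∀ x, HasDerivAt ψ (v x) x) (hv : ∀ x, 0 < v x) (g : ℝ → ℝ) :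
    ∫ y, g y = ∫ x, v x * g (ψ x) := by
  have := integral_image_eq_integral_abs_deriv_smul (s := univ) MeasurableSet.univ
    (fun x _ => (hd x).hasDerivWithinAt) hψ.1.injOn g
  rw [image_univ, hψ.2.range_eq] at this
  simpa [abs_of_pos (hv _)] using this

lemma integrable_iff_comp_mul_deriv_of_bijective {v : ℝ → ℝ} (hψ : Function.Bijective ψ)
    (hd : ∀ x, HasDerivAt ψ (v x) x) (hv : ∀ x, 0 < v x) (g : ℝ → ℝ) :
    Integrable g ↔ Integrable (fun x => v x * g (ψ x)) := by
  have := integrableOn_image_iff_integrableOn_abs_deriv_smul (s := univ) MeasurableSet.univ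
    (fun x _ => (hd x).hasDerivWithinAt) hψ.1.injOn g
  rw [image_univ, hψ.2.range_eq] at this
  simpa [abs_of_pos (hv _)] using this

lemma IsTameDiffeo.deriv_pos (h : IsTameDiffeo ψ u) (y : ℝ) : 0 < u y := by
  obtain ⟨δ, hδ, hu⟩ := h.pos
  exact hδ.trans_le (hu y)

/-- Bootstrapping in the differential equation `ψ' = u ∘ ψ`. -/
lemma IsTameDiffeo.contDiff (h : IsTameDiffeo ψ u) : ContDiff ℝ ∞ ψ := by
  have hu : ContDiff ℝ ∞ u := h.controlled.smooth.comp_right 0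
  rw [contDiff_infty]
  intro n
  induction n with
  | zero =>
    rw [Nat.cast_zero, contDiff_zero]
    exact continuous_iff_continuousAt.2 fun x => (h.hasDerivAt x).continuousAt
  | succ n ih =>
    rw [Nat.cast_succ, contDiff_succ_iff_deriv]
    refine ⟨fun x => (h.hasDerivAt x).differentiableAt, by simp, ?_⟩
    rw [funext fun x => (h.hasDerivAt x).deriv]
    exact (hu.of_le (mod_cast le_top)).comp ih

/-- Writing the derivative of `ψ` as `u ∘ ψ` gives `∂ₓ(g ∘ ψ) = (∂ₓ g · u) ∘ ψ`, again a composite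
with `ψ`, so the induction closes. -/
lemma Controlled.comp_diffeo {P : (ℝ → ℝ → ℝ) → Prop} (hP : IsControl P) (h : IsTameDiffeo ψ u)
    (hψ : ∀ g, Smooth₂ g → P g → P (fun t x => g t (ψ x))) {g : ℝ → ℝ → ℝ}
    (hg : Controlled P g) : Controlled P (fun t x => g t (ψ x)) := by
  have hs : ∀ g, Smooth₂ g → Smooth₂ (fun t x => g t (ψ x)) := fun g hg =>
    hg.comp (contDiff_fst.prodMk (h.contDiff.comp contDiff_snd))
  intro N
  induction N generalizing g with
  | zero => exact ⟨hs g hg.smooth, hψ g hg.smooth hg.prop⟩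
  | succ N ih =>
    refine ⟨⟨hs g hg.smooth, hψ g hg.smooth hg.prop⟩, ih hg.velocity, ?_⟩
    have e : SquareRootRep.spaceDeriv (fun t x => g t (ψ x)) =
        fun t x => SquareRootRep.spaceDeriv g t (ψ x) * u (ψ x) := by
      ext t x
      exact ((hg.smooth.hasDerivAt_right t (ψ x)).comp x (h.hasDerivAt x)).deriv
    rw [e]
    exact ih (g := SquareRootRep.spaceDeriv g * fun _ => u) (hg.spaceDeriv.mul hP h.controlled)

/-- Supports move by at most `C`, the weights at `x` and `ψ x` are comparable, and the lower bound
on `ψ'` controls the `L¹` norm after substitution. -/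
lemma IsTameDiffeo.locallyControlled_comp (h : IsTameDiffeo ψ u) {g : ℝ → ℝ → ℝ}
    (hg : Smooth₂ g) (hc : LocallyControlled A g) :
    LocallyControlled A (fun t x => g t (ψ x)) := by
  obtain ⟨C, hC⟩ := h.close
  cases A with
  | compactlySupported =>
    intro T
    obtain ⟨r, hr⟩ := hc T
    refine ⟨r + C, fun t ht x hx => hr t ht _ ?_⟩
    have := abs_add_le (ψ x) (x - ψ x)
    rw [add_sub_cancel, abs_sub_comm] at this
    linarith [hC x]
  | schwartz =>
    intro T m
    obtain ⟨D, hD⟩ := hc T m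
    refine ⟨(2 + 2 * C ^ 2) ^ m * D, fun t ht x => ?_⟩
    have h1 : 1 + x ^ 2 ≤ (2 + 2 * C ^ 2) * (1 + ψ x ^ 2) := by
      have h2 : (ψ x - x) ^ 2 ≤ C ^ 2 := by
        rw [← sq_abs]
        exact pow_le_pow_left₀ (abs_nonneg _) (hC x) 2
      -- The first square is `x² ≤ 2ψ² + 2(ψ - x)²`.
      nlinarith [sq_nonneg (2 * ψ x - x), mul_nonneg (sq_nonneg C) (sq_nonneg (ψ x))]
    calc (1 + x ^ 2) ^ m * |g t (ψ x)|
        ≤ ((2 + 2 * C ^ 2) * (1 + ψ x ^ 2)) ^ m * |g t (ψ x)| := by gcongr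
      _ = (2 + 2 * C ^ 2) ^ m * ((1 + ψ x ^ 2) ^ m * |g t (ψ x)|) := by rw [mul_pow]; ring
      _ ≤ (2 + 2 * C ^ 2) ^ m * D := by gcongr; exact hD t ht _
  | sobolevL1 =>
    intro T
    obtain ⟨D, hD⟩ := hc T
    obtain ⟨δ, hδ, hu⟩ := h.pos
    refine ⟨δ⁻¹ * D, fun t ht => ?_⟩
    have hi := (integrable_iff_comp_mul_deriv_of_bijective h.bijective h.hasDerivAt
      (fun x => h.deriv_pos _) _).1 (hD t ht).1.abs
    have e := integral_comp_mul_deriv_of_bijective h.bijective h.hasDerivAt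
      (fun x => h.deriv_pos _) (fun y => |g t y|)
    have hle : ∀ x, |g t (ψ x)| ≤ δ⁻¹ * (u (ψ x) * |g t (ψ x)|) := by
      intro x
      rw [← mul_assoc]
      refine le_mul_of_one_le_left (abs_nonneg _) ?_
      rw [inv_mul_eq_div, one_le_div hδ]
      exact hu _
    have hig : Integrable (fun x => g t (ψ x)) :=
      (hi.const_mul δ⁻¹).mono'
        ((hg.comp_right t).continuous.comp h.contDiff.continuous).aestronglyMeasurable
        (Eventually.of_forall hle)
    refine ⟨hig, ?_⟩
    calc ∫ x, |g t (ψ x)| ≤ ∫ x, δ⁻¹ * (u (ψ x) * |g t (ψ x)|) :=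
          integral_mono hig.abs (hi.const_mul _) hle
      _ = δ⁻¹ * ∫ y, |g t y| := by rw [integral_const_mul, e]
      _ ≤ δ⁻¹ * D := by gcongr; exact (hD t ht).2

lemma IsTameDiffeo.comp_mem_space (h : IsTameDiffeo ψ u) {g : ℝ → ℝ} (hg : g ∈ space A) :
    g ∘ ψ ∈ space A := by
  rw [mem_space_iff] at hg ⊢
  exact Controlled.comp_diffeo (isControl_locallyControlled A) h
    (fun g hg hc => h.locallyControlled_comp hg hc) hg

lemma hasDerivAt_of_inverse {v : ℝ → ℝ} (hd : ∀ x, HasDerivAt ψ (v x) x) (hv : ∀ x, 0 < v x)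
    (hr : Function.RightInverse χ ψ) (y : ℝ) :
    HasDerivAt χ (v (χ y))⁻¹ y := by
  have hm : StrictMono ψ := strictMono_of_deriv_pos fun x => by rw [(hd x).deriv]; exact hv x
  -- The inverse of a strictly increasing surjection is an order isomorphism, hence continuous, as
  -- the inverse function rule requires.
  have hχ : χ = (hm.orderIsoOfSurjective ψ hr.surjective).symm := by
    ext y
    apply hm.injective
    rw [hr y]
    exact ((hm.orderIsoOfSurjective ψ hr.surjective).apply_symm_apply y).symm
  have hc : Continuous χ := by rw [hχ]; exact OrderIso.continuous _
  exact (hd (χ y)).of_local_left_inverse hc.continuousAt (hv _).ne' (Eventually.of_forall hr)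

/-- The function `y ↦ 1 / y` is smooth on `(0, ∞)`. -/
lemma contDiffOn_inv_Ioi : ContDiffOn ℝ ∞ (fun y : ℝ => y⁻¹) (Ioi 0) :=
  fun _ hy => (contDiffAt_inv ℝ (ne_of_gt hy)).contDiffWithinAt

lemma IsTameDiffeo.inverse (h : IsTameDiffeo ψ u)
    (hl : Function.LeftInverse χ ψ) (hr : Function.RightInverse χ ψ) :
    IsTameDiffeo χ (fun y => (u (ψ y))⁻¹) where
  bijective := ⟨hr.injective, hl.surjective⟩
  hasDerivAt := hasDerivAt_of_inverse h.hasDerivAt (fun _ => h.deriv_pos _) hr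
  controlled := by
    obtain ⟨δ, hδ, hu⟩ := h.pos
    have h1 : Controlled LocallyBounded (fun _ x => u (ψ x)) :=
      Controlled.comp_diffeo isControl_locallyBounded h
        (fun g _ hb T => (hb T).imp fun C hC t ht x => hC t ht _) h.controlled
    exact h1.comp_outer contDiffOn_inv_Ioi
      (fun T => ⟨δ, hδ, fun _ _ x => by rw [zero_add]; exact hu _⟩)
  pos := by
    obtain ⟨C, hC⟩ := h.controlled.prop 0
    have hC : ∀ y, u y ≤ C := fun y => (le_abs_self _).trans (hC 0 (by simp) y)
    have hC0 : 0 < C := (h.deriv_pos 0).trans_le (hC 0)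
    exact ⟨C⁻¹, by positivity, fun y => inv_anti₀ (h.deriv_pos _) (hC _)⟩
  close := by
    obtain ⟨C, hC⟩ := h.close
    refine ⟨C, fun y => ?_⟩
    have := hC (χ y)
    rwa [hr y, abs_sub_comm] at this

end Diffeomorphisms

/-! ### Uniqueness of the Levi-Civita derivative and flatness -/

section Flatness

variable {M : FunctionManifold} {G : MetricField} {Γ Γ₀ : Christoffel}

/-- The properties of the manifolds under consideration which are needed for the uniqueness of
Levi-Civita derivatives. -/
structure IsOpenInModel (M : FunctionManifold) : Prop where
  sub_mem : ∀ h ∈ M.model, ∀ k ∈ M.model, h - k ∈ M.model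
  const_mem : ∀ h ∈ M.model, (fun _ => h) ∈ M.modelCurves
  carrier_of_curves : ∀ c ∈ M.curves, ∀ t, c t ∈ M.carrier
  exists_curve : ∀ φ ∈ M.carrier, ∀ h ∈ M.model,
    ∃ c ∈ M.curves, ∀ᶠ t in 𝓝 (0 : ℝ), c t = φ + t • h

lemma velocity_eq_of_eventually {c : ℝ → ℝ → ℝ} {φ h : ℝ → ℝ}
    (hc : ∀ᶠ t in 𝓝 (0 : ℝ), c t = φ + t • h) : velocity c 0 = h := by
  ext x
  have e : (fun s => c s x) =ᶠ[𝓝 0] fun s => φ x + s * h x := by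
    filter_upwards [hc] with s hs
    rw [hs]; rfl
  have hd : HasDerivAt (fun s : ℝ => φ x + s * h x) (h x) 0 := by
    simpa using ((hasDerivAt_id (0 : ℝ)).mul_const (h x)).const_add (φ x)
  exact e.deriv_eq.trans hd.deriv

lemma IsRiemannianMetric.sub_left (hG : IsRiemannianMetric M G) (hM : IsOpenInModel M)
    {φ h₁ h₂ k : ℝ → ℝ} (hφ : φ ∈ M.carrier) (h1 : h₁ ∈ M.model) (h2 : h₂ ∈ M.model)
    (hk : k ∈ M.model) : G φ (h₁ - h₂) k = G φ h₁ k - G φ h₂ k := by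
  have := hG.add_left φ hφ (h₁ - h₂) (hM.sub_mem _ h1 _ h2) h₂ h2 k hk
  rw [sub_add_cancel] at this
  linarith

/-- Constant fields `h`, `k` along a curve with velocity `X` have zero velocity, so compatibility
expresses one and the same derivative of `G` through `Γ` and through `Γ₀`. -/
lemma IsLeviCivita.compat_eq (hΓ : IsLeviCivita M G Γ) (hΓ₀ : IsLeviCivita M G Γ₀)
    (hM : IsOpenInModel M) {φ X h k : ℝ → ℝ} (hφ : φ ∈ M.carrier) (hX : X ∈ M.model)
    (hh : h ∈ M.model) (hk : k ∈ M.model) :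
    G φ (Γ φ X h) k + G φ h (Γ φ X k) = G φ (Γ₀ φ X h) k + G φ h (Γ₀ φ X k) := by
  obtain ⟨c, hc, he⟩ := hM.exists_curve φ hφ X hX
  have h0 : c 0 = φ := by simpa using he.self_of_nhds
  have hv := velocity_eq_of_eventually he
  have hz : ∀ l : ℝ → ℝ, velocity (fun _ => l) 0 = 0 := fun l => by
    ext x; exact deriv_const 0 (l x)
  have h1 := hΓ.metric c hc _ (hM.const_mem h hh) _ (hM.const_mem k hk) 0
  have h2 := hΓ₀.metric c hc _ (hM.const_mem h hh) _ (hM.const_mem k hk) 0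
  have := h1.unique h2
  simpa only [covDeriv, hz, zero_add, hv, h0] using this

/-- The difference `B` is symmetric in its arguments, while `G(B(X, Y), Z)` is skew in `Y` and `Z`;
such a trilinear form vanishes. Testing against `B(h, k)` itself then needs only definiteness. -/
lemma IsLeviCivita.unique (hG : IsRiemannianMetric M G) (hΓ : IsLeviCivita M G Γ)
    (hΓ₀ : IsLeviCivita M G Γ₀) (hM : IsOpenInModel M) {φ h k : ℝ → ℝ} (hφ : φ ∈ M.carrier)
    (hh : h ∈ M.model) (hk : k ∈ M.model) : Γ φ h k = Γ₀ φ h k := by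
  set B : (ℝ → ℝ) → (ℝ → ℝ) → ℝ → ℝ := fun X Y => Γ φ X Y - Γ₀ φ X Y with hB
  have hBm : ∀ X ∈ M.model, ∀ Y ∈ M.model, B X Y ∈ M.model := fun X hX Y hY =>
    hM.sub_mem _ (hΓ.mem φ hφ X hX Y hY) _ (hΓ₀.mem φ hφ X hX Y hY)
  have hsymm : ∀ X ∈ M.model, ∀ Y ∈ M.model, B X Y = B Y X := fun X hX Y hY => by
    simp only [hB]
    rw [hΓ.symm φ hφ X hX Y hY, hΓ₀.symm φ hφ X hX Y hY]
  have hskew : ∀ X ∈ M.model, ∀ Y ∈ M.model, ∀ Z ∈ M.model,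
      G φ (B X Y) Z = - G φ (B X Z) Y := by
    intro X hX Y hY Z hZ
    have h1 := hΓ.mem φ hφ X hX
    have h2 := hΓ₀.mem φ hφ X hX
    have e := hΓ.compat_eq hΓ₀ hM hφ hX hY hZ
    rw [hG.symm φ hφ Y hY _ (h1 Z hZ), hG.symm φ hφ Y hY _ (h2 Z hZ)] at e
    simp only [hB]
    rw [hG.sub_left hM hφ (h1 Y hY) (h2 Y hY) hZ, hG.sub_left hM hφ (h1 Z hZ) (h2 Z hZ) hY]
    linarith
  have hzero : ∀ Z ∈ M.model, G φ (B h k) Z = 0 := by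
    intro Z hZ
    -- Alternating the skew and the symmetric exchange returns `G(B(h, k), Z)` to itself with the
    -- opposite sign.
    have e1 := hskew h hh k hk Z hZ
    have e2 := hskew Z hZ h hh k hk
    have e3 := hskew k hk Z hZ h hh
    rw [hsymm h hh Z hZ] at e1
    rw [hsymm Z hZ k hk] at e2
    rw [hsymm k hk h hh] at e3
    linarith
  by_contra hne
  have hp := hG.pos φ hφ (B h k) (hBm h hh k hk) (sub_ne_zero.2 hne)
  rw [hzero _ (hBm h hh k hk)] at hp
  exact lt_irrefl _ hp

/-- Christoffel symbols are determined only at points of the manifold. Since `φ + t h` stays there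
for small `t`, their derivatives at `φ` agree as well. -/
lemma isFlat_of_leviCivita (hG : IsRiemannianMetric M G) (hΓ₀ : IsLeviCivita M G Γ₀)
    (hM : IsOpenInModel M)
    (hflat : ∀ φ ∈ M.carrier, ∀ h ∈ M.model, ∀ k ∈ M.model, ∀ l ∈ M.model,
      curvature Γ₀ φ h k l = 0) : IsFlat M G := by
  refine ⟨hG, ⟨Γ₀, hΓ₀⟩, fun Γ hΓ φ hφ h hh k hk l hl => ?_⟩
  have hu : ∀ ψ ∈ M.carrier, ∀ h ∈ M.model, ∀ k ∈ M.model, Γ ψ h k = Γ₀ ψ h k :=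
    fun ψ hψ h hh k hk => hΓ.unique hG hΓ₀ hM hψ hh hk
  have ht : ∀ h ∈ M.model, ∀ k ∈ M.model,
      tangentMap (fun ψ => Γ ψ k l) φ h = tangentMap (fun ψ => Γ₀ ψ k l) φ h := by
    intro h hh k hk
    obtain ⟨c, hc, he⟩ := hM.exists_curve φ hφ h hh
    ext x
    refine EventuallyEq.deriv_eq ?_
    filter_upwards [he] with t ht
    have := hM.carrier_of_curves c hc t
    rw [ht] at this
    exact congrFun (hu _ this k hk l hl) x
  rw [← hflat φ hφ h hh k hk l hl, curvature, curvature, ht h hh k hk, ht k hk h hh,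
    hu φ hφ k hk l hl, hu φ hφ h hh l hl, hu φ hφ h hh _ (hΓ₀.mem φ hφ k hk l hl),
    hu φ hφ k hk _ (hΓ₀.mem φ hφ h hh l hl)]

end Flatness

/-! ### The model spaces -/

section ModelSpaces

variable {A : FunctionClass}

/-- Curves live on all of `ℝ` whereas `φ + t h` may leave the open set; replacing `t` by a small `s
t` equal to `t` near `0` repairs this. -/
lemma exists_contDiff_cutoff {ε : ℝ} (hε : 0 < ε) :
    ∃ s : ℝ → ℝ, ContDiff ℝ ∞ s ∧ (∀ t, |s t| < ε) ∧ ∀ᶠ t in 𝓝 0, s t = t := by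
  let b : ContDiffBump (0 : ℝ) := ⟨ε / 4, ε / 2, by positivity, by linarith⟩
  refine ⟨fun t => t * b t, contDiff_id.mul b.contDiff, fun t => ?_, ?_⟩
  · change |t * b t| < ε
    by_cases ht : |t| < ε
    · rw [abs_mul, abs_of_nonneg b.nonneg]
      exact (mul_le_of_le_one_right (abs_nonneg t) b.le_one).trans_lt ht
    · rw [b.zero_of_le_dist]
      · simpa using hε
      · rw [Real.dist_eq, sub_zero]
        change ε / 2 ≤ |t|
        linarith
  · filter_upwards [b.eventuallyEq_one] with t ht
    rw [ht]; simp

lemma mem_space_add {f g : ℝ → ℝ} (hf : f ∈ space A) (hg : g ∈ space A) : f + g ∈ space A := by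
  rw [mem_space_iff] at *
  exact hf.add (isControl_locallyControlled A) hg

lemma mem_space_smul {f : ℝ → ℝ} (hf : f ∈ space A) (a : ℝ) : a • f ∈ space A := by
  rw [mem_space_iff] at *
  exact hf.const_mul (isControl_locallyControlled A) a

lemma mem_space_sub {f g : ℝ → ℝ} (hf : f ∈ space A) (hg : g ∈ space A) : f - g ∈ space A := by
  have := mem_space_add hf (mem_space_smul hg (-1))
  rwa [neg_one_smul, ← sub_eq_add_neg] at this

lemma controlled_zero : Controlled (LocallyControlled A) 0 := by
  refine (controlled_const_iff (f := 0) (locallyControlled_zero A)).2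
    ⟨contDiff_const, fun n => ?_⟩
  have : iteratedDeriv n (0 : ℝ → ℝ) = 0 := by
    ext x
    simp [Pi.zero_def]
  rw [this]
  exact locallyControlled_zero A

lemma space₁_differentiable {f : ℝ → ℝ} (hf : f ∈ space₁ A) : Differentiable ℝ f :=
  hf.1.differentiable (by simp)

lemma mem_space₁_sub {f g : ℝ → ℝ} (hf : f ∈ space₁ A) (hg : g ∈ space₁ A) :
    f - g ∈ space₁ A := by
  refine ⟨hf.1.sub hg.1, ?_, by simpa only [sub_zero] using! hf.2.2.sub hg.2.2⟩
  have : deriv (f - g) = deriv f - deriv g := by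
    ext x
    exact deriv_sub (space₁_differentiable hf x) (space₁_differentiable hg x)
  rw [this]
  exact mem_space_sub hf.2.1 hg.2.1

lemma controlled_spaceDeriv_of_curves₁ {c : ℝ → ℝ → ℝ} (hc : c ∈ curves₁ A) :
    Controlled (LocallyControlled A) (spaceDeriv c) := mem_curves_iff.1 hc.2.1

lemma const_mem_curves₁ {f : ℝ → ℝ} (hf : f ∈ space₁ A) : (fun _ => f) ∈ curves₁ A :=
  ⟨smooth₂_const hf.1, mem_curves_iff.2 (mem_space_iff.1 hf.2.1), fun _ => hf.2.2⟩

lemma mem_space₁_of_curves₁ {c : ℝ → ℝ → ℝ} (hc : c ∈ curves₁ A) (t : ℝ) : c t ∈ space₁ A :=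
  ⟨Smooth₂.comp_right hc.1 t, (controlled_spaceDeriv_of_curves₁ hc).mem_space t, hc.2.2 t⟩

lemma integrable_of_mem_space {f : ℝ → ℝ} (hf : f ∈ space A) : Integrable f :=
  (mem_space_iff.1 hf).integrable 0

lemma space₁_eq_integral {f : ℝ → ℝ} (hf : f ∈ space₁ A) (x : ℝ) :
    ∫ y in Iic x, deriv f y = f x := by
  have := integral_Iic_of_hasDerivAt_of_tendsto' (a := x)
    (fun y _ => (space₁_differentiable hf y).hasDerivAt)
    (integrable_of_mem_space hf.2.1).integrableOn hf.2.2
  simpa using this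

lemma space₁_bounded {f : ℝ → ℝ} (hf : f ∈ space₁ A) (x : ℝ) : |f x| ≤ ∫ y, |deriv f y| := by
  rw [← space₁_eq_integral hf x]
  exact abs_integral_le_integral_abs.trans (setIntegral_le_integral
    (integrable_of_mem_space hf.2.1).abs (Eventually.of_forall fun y => abs_nonneg _))

lemma exists_bound_of_mem_space {f : ℝ → ℝ} (hf : f ∈ space A) :
    ∃ C > 0, ∀ x, |f x| ≤ C := by
  obtain ⟨C, hC⟩ := (mem_space_iff.1 hf).locallyBounded.prop 0
  exact ⟨max C 1, by positivity, fun x => (hC 0 (by simp) x).trans (le_max_left _ _)⟩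

lemma exists_perturbation {f h : ℝ → ℝ} {a : ℝ} (ha : a < 0) (hf : f ∈ space A)
    (hh : h ∈ space A) (hb : ∀ x, a < f x) :
    ∃ s : ℝ → ℝ, ContDiff ℝ ∞ s ∧ (∀ᶠ t in 𝓝 0, s t = t) ∧ ∀ t x, a < f x + s t * h x := by
  obtain ⟨ε, hε, hε'⟩ := (mem_space_iff.1 hf).exists_lower_bound (t := 0) ha hb
  obtain ⟨C, hC, hC'⟩ := exists_bound_of_mem_space hh
  obtain ⟨s, hs, hsb, hse⟩ := exists_contDiff_cutoff (show 0 < ε / C by positivity)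
  refine ⟨s, hs, hse, fun t x => ?_⟩
  have h1 : |s t * h x| < ε := by
    rw [abs_mul]
    calc |s t| * |h x| ≤ |s t| * C := by gcongr; exact hC' x
      _ < ε / C * C := by gcongr; exact hsb t
      _ = ε := by field_simp
  linarith [hε' x, (abs_lt.1 h1).1]

end ModelSpaces

/-! ### The space `𝒜(ℝ, ℝ_{>-2})` with the `L²`-metric -/

section Target

variable {A : FunctionClass}

lemma isOpenInModel_target (A : FunctionClass) : IsOpenInModel (target A) where
  sub_mem h hh k hk := mem_space_sub hh hk
  const_mem h hh := mem_curves_iff.2 (mem_space_iff.1 hh)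
  carrier_of_curves c hc := hc.1
  exists_curve φ hφ h hh := by
    obtain ⟨s, hs, hse, hsb⟩ := exists_perturbation (by norm_num) hφ.1 hh hφ.2
    have hA := isControl_locallyControlled A
    have hc : Controlled (LocallyControlled A) ((fun _ => φ) + (fun _ => h) * fun t _ => s t) :=
      (mem_space_iff.1 hφ.1).add hA ((mem_space_iff.1 hh).mul hA (Controlled.of_time hs))
    refine ⟨_, ⟨fun t => ⟨hc.mem_space t, fun x => ?_⟩, mem_curves_iff.2 hc⟩, ?_⟩
    · have := hsb t x
      rwa [mul_comm] at this
    · filter_upwards [hse] with t ht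
      ext x
      simp [ht, mul_comm]

/-- The weight is `1` for the `L²`-metric and `1/φ'` for the `Ḣ¹`-metric. -/
lemma integral_mul_self_pos {h w : ℝ → ℝ} (hh : Continuous h) (hw : Continuous w)
    (hw0 : ∀ x, 0 < w x) (hi : Integrable (fun x => h x * h x * w x)) (hne : h ≠ 0) :
    0 < ∫ x, h x * h x * w x := by
  obtain ⟨x, hx⟩ := Function.ne_iff.1 hne
  exact integral_pos_of_integrable_nonneg_nonzero (x := x) ((hh.mul hh).mul hw) hi
    (fun x => mul_nonneg (mul_self_nonneg _) (hw0 x).le)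
    (mul_ne_zero (mul_self_ne_zero.2 hx) (hw0 x).ne')

lemma isRiemannianMetric_metricL2 (A : FunctionClass) :
    IsRiemannianMetric (target A) metricL2 := by
  have hi : ∀ h ∈ space A, ∀ k ∈ space A, Integrable (fun x => h x * k x) := fun h hh k hk =>
    ((mem_space_iff.1 hh).mul_self (mem_space_iff.1 hk)).integrable 0
  refine ⟨?_, ?_, ?_, ?_, ?_⟩
  · intro φ _ h₁ h1 h₂ h2 k hk
    simp only [metricL2, Pi.add_apply, add_mul]
    exact integral_add (hi _ h1 _ hk) (hi _ h2 _ hk)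
  · intro φ _ a h _ k _
    simp only [metricL2, Pi.smul_apply, smul_eq_mul, mul_assoc]
    exact integral_const_mul _ _
  · intro φ _ h _ k _
    simp only [metricL2, mul_comm]
  · intro φ _ h hh hne
    have hc : Continuous h := ((mem_space_iff.1 hh).smooth.comp_right 0).continuous
    have := integral_mul_self_pos hc continuous_const (w := fun _ => 1) (fun _ => one_pos)
      (by simpa using hi h hh h hh) hne
    simpa [metricL2] using this
  · intro c _ h hh k hk
    exact ((mem_curves_iff.1 hh).mul_self (mem_curves_iff.1 hk)).contDiff_integral

lemma isLeviCivita_metricL2 (A : FunctionClass) :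
    IsLeviCivita (target A) metricL2 (fun _ _ _ => 0) := by
  refine ⟨fun _ _ _ _ _ _ => controlled_zero.mem_space 0,
    fun _ _ _ _ _ _ => mem_curves_iff.2 controlled_zero, ?_, ?_, ?_, ?_⟩
  · simp
  · simp
  · simp
  · intro c _ h hh k hk t
    have hh := mem_curves_iff.1 hh
    have hk := mem_curves_iff.1 hk
    have := (hh.mul_self hk).hasDerivAt_integral t
    rw [velocity_mul hh.smooth hk.smooth] at this
    simp only [metricL2, covDeriv, add_zero]
    exact this.congr_deriv (integral_add ((hh.velocity.mul_self hk).integrable t)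
      ((hh.mul_self hk.velocity).integrable t))

lemma isFlat_target (A : FunctionClass) : IsFlat (target A) metricL2 := by
  refine isFlat_of_leviCivita (isRiemannianMetric_metricL2 A) (isLeviCivita_metricL2 A)
    (isOpenInModel_target A) fun φ _ h _ k _ l _ => ?_
  ext x
  simp [curvature, tangentMap]

end Target

/-! ### The diffeomorphism group -/

section DiffGroup

variable {A : FunctionClass} {φ : ℝ → ℝ} {c h k : ℝ → ℝ → ℝ}

lemma const_mem_curves_diffGroup (hφ : φ ∈ (diffGroup A).carrier) :
    (fun _ => φ) ∈ (diffGroup A).curves :=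
  ⟨fun _ => hφ, const_mem_curves₁ hφ.1⟩

lemma smooth₂_of_diffGroup (hc : c ∈ (diffGroup A).curves) : Smooth₂ c := by
  have : Smooth₂ fun t x => (c t x - x) + x :=
    ContDiff.add (f := Function.uncurry fun t x => c t x - x) hc.2.1 contDiff_snd
  simpa using this

lemma contDiff_of_diffGroup (hφ : φ ∈ (diffGroup A).carrier) : ContDiff ℝ ∞ φ :=
  (smooth₂_of_diffGroup (const_mem_curves_diffGroup hφ)).comp_right 0

lemma deriv_sub_id_of_diffGroup (hφ : φ ∈ (diffGroup A).carrier) :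
    deriv (fun x => φ x - x) = fun x => deriv φ x - 1 := by
  ext x
  exact (((contDiff_of_diffGroup hφ).differentiable (by simp) x).hasDerivAt.sub
    (hasDerivAt_id x)).deriv

lemma deriv_pos_of_diffGroup (hφ : φ ∈ (diffGroup A).carrier) (x : ℝ) : 0 < deriv φ x := by
  have := hφ.2 x
  rw [deriv_sub_id_of_diffGroup hφ] at this
  linarith

lemma controlled_deriv_sub_one (hc : c ∈ (diffGroup A).curves) :
    Controlled (LocallyControlled A) (fun t x => deriv (c t) x - 1) := by
  have := controlled_spaceDeriv_of_curves₁ hc.2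
  rwa [show spaceDeriv (fun t x => c t x - x) = fun t x => deriv (c t) x - 1 from
    funext fun t => deriv_sub_id_of_diffGroup (hc.1 t)] at this

lemma locallyBoundedBelow_deriv_sub_one (hc : c ∈ (diffGroup A).curves) :
    LocallyBoundedBelow (-1) (fun t x => deriv (c t) x - 1) :=
  (controlled_deriv_sub_one hc).locallyBoundedBelow (by norm_num) fun t x => by
    linarith [deriv_pos_of_diffGroup (hc.1 t) x]

lemma contDiffOn_inv_one_add : ContDiffOn ℝ ∞ (fun y : ℝ => (1 + y)⁻¹) (Ioi (-1)) :=
  contDiffOn_inv_Ioi.comp (contDiff_const.add contDiff_id).contDiffOn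
    fun y (hy : -1 < y) => show 0 < 1 + y by linarith

/-- Superposition of `φ' - 1` with `1/(1 + y)`, which equals `1` at `0`: the result is bounded but
does not decay. -/
lemma controlled_inv_deriv (hc : c ∈ (diffGroup A).curves) :
    Controlled LocallyBounded (fun t x => (deriv (c t) x)⁻¹) := by
  have := (controlled_deriv_sub_one hc).locallyBounded.comp_outer contDiffOn_inv_one_add
    (locallyBoundedBelow_deriv_sub_one hc)
  simpa using this

/-- As `φ - Id` is bounded, `φ` tends to `±∞` at `±∞`. -/
lemma bijective_of_diffGroup (hφ : φ ∈ (diffGroup A).carrier) : Function.Bijective φ := by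
  have hc := (contDiff_of_diffGroup hφ).continuous
  have hb := space₁_bounded hφ.1
  set C := ∫ y, |deriv (fun x => φ x - x) y|
  refine ⟨(strictMono_of_deriv_pos (deriv_pos_of_diffGroup hφ)).injective,
    hc.surjective ?_ ?_⟩
  · refine tendsto_atTop_mono (f := fun x => x + -C) (fun x => ?_)
      (tendsto_atTop_add_const_right _ _ tendsto_id)
    linarith [(abs_le.1 (hb x)).1]
  · refine tendsto_atBot_mono (f := fun x => x + C) (fun x => ?_)
      (tendsto_atBot_add_const_right _ _ tendsto_id)
    linarith [(abs_le.1 (hb x)).2]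

lemma leftInverse_invFun_of_diffGroup (hφ : φ ∈ (diffGroup A).carrier) :
    Function.LeftInverse (Function.invFun φ) φ :=
  Function.leftInverse_invFun (bijective_of_diffGroup hφ).1

lemma rightInverse_invFun_of_diffGroup (hφ : φ ∈ (diffGroup A).carrier) :
    Function.RightInverse (Function.invFun φ) φ :=
  Function.rightInverse_invFun (bijective_of_diffGroup hφ).2

lemma hasDerivAt_of_diffGroup (hφ : φ ∈ (diffGroup A).carrier) (x : ℝ) :
    HasDerivAt φ (deriv φ x) x :=
  ((contDiff_of_diffGroup hφ).differentiable (by simp) x).hasDerivAt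

/-- The inverse comes first because `(φ⁻¹)' = (1/φ') ∘ φ⁻¹` has the form `u ∘ ψ` with a known `u`;
the statement for `φ` follows by inverting. -/
lemma isTameDiffeo_invFun (hφ : φ ∈ (diffGroup A).carrier) :
    IsTameDiffeo (Function.invFun φ) (fun x => (deriv φ x)⁻¹) where
  bijective := ⟨(rightInverse_invFun_of_diffGroup hφ).injective,
    (leftInverse_invFun_of_diffGroup hφ).surjective⟩
  hasDerivAt := hasDerivAt_of_inverse (hasDerivAt_of_diffGroup hφ) (deriv_pos_of_diffGroup hφ)
    (rightInverse_invFun_of_diffGroup hφ)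
  controlled := controlled_inv_deriv (const_mem_curves_diffGroup hφ)
  pos := by
    have hc := controlled_deriv_sub_one (const_mem_curves_diffGroup hφ)
    obtain ⟨C, hC⟩ := hc.locallyBounded.prop 0
    have hC : ∀ x, deriv φ x ≤ C + 1 := fun x => by
      linarith [(abs_le.1 (hC 0 (by simp) x)).2]
    have h0 : 0 < C + 1 := (deriv_pos_of_diffGroup hφ 0).trans_le (hC 0)
    exact ⟨(C + 1)⁻¹, by positivity, fun x => inv_anti₀ (deriv_pos_of_diffGroup hφ x) (hC x)⟩
  close := by
    refine ⟨∫ x, |deriv (fun x => φ x - x) x|, fun y => ?_⟩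
    have := space₁_bounded hφ.1 (Function.invFun φ y)
    rwa [rightInverse_invFun_of_diffGroup hφ y, abs_sub_comm] at this

lemma isTameDiffeo_of_diffGroup (hφ : φ ∈ (diffGroup A).carrier) :
    IsTameDiffeo φ (fun y => ((deriv φ (Function.invFun φ y))⁻¹)⁻¹) :=
  (isTameDiffeo_invFun hφ).inverse (rightInverse_invFun_of_diffGroup hφ)
    (leftInverse_invFun_of_diffGroup hφ)

lemma IsTameDiffeo.tendsto_atBot {ψ u : ℝ → ℝ} (h : IsTameDiffeo ψ u) :
    Tendsto ψ atBot atBot := by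
  obtain ⟨C, hC⟩ := h.close
  refine tendsto_atBot_mono (f := fun x => x + C) (fun x => ?_)
    (tendsto_atBot_add_const_right _ _ tendsto_id)
  linarith [(abs_le.1 (hC x)).2]

lemma comp_mem_space₁ (hφ : φ ∈ (diffGroup A).carrier) {X : ℝ → ℝ} (hX : X ∈ space₁ A) :
    X ∘ φ ∈ space₁ A := by
  have ht := isTameDiffeo_of_diffGroup hφ
  refine ⟨hX.1.comp ht.contDiff, ?_, hX.2.2.comp ht.tendsto_atBot⟩
  -- Splitting `φ' = 1 + (φ' - 1)` exhibits factors that all lie in `𝒜(ℝ)`.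
  have e : deriv (X ∘ φ) = (deriv X ∘ φ) + (deriv X ∘ φ) * fun x => deriv φ x - 1 := by
    ext x
    rw [((space₁_differentiable hX (φ x)).hasDerivAt.comp x
      (hasDerivAt_of_diffGroup hφ x)).deriv]
    simp only [Pi.add_apply, Pi.mul_apply, Function.comp]
    ring
  rw [e]
  have h1 := ht.comp_mem_space hX.2.1
  refine mem_space_add h1 ?_
  rw [mem_space_iff] at h1 ⊢
  exact h1.mul_self (controlled_deriv_sub_one (const_mem_curves_diffGroup hφ))

lemma deriv_comp_invFun (hφ : φ ∈ (diffGroup A).carrier) {X : ℝ → ℝ}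
    (hX : Differentiable ℝ X) (y : ℝ) : deriv (X ∘ Function.invFun φ) y =
      deriv X (Function.invFun φ y) * (deriv φ (Function.invFun φ y))⁻¹ :=
  ((hX _).hasDerivAt.comp y ((isTameDiffeo_invFun hφ).hasDerivAt y)).deriv

lemma comp_invFun_mem_space₁ (hφ : φ ∈ (diffGroup A).carrier) {X : ℝ → ℝ}
    (hX : X ∈ space₁ A) : X ∘ Function.invFun φ ∈ space₁ A := by
  have ht := isTameDiffeo_invFun hφ
  refine ⟨hX.1.comp ht.contDiff, ?_, hX.2.2.comp ht.tendsto_atBot⟩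
  have e : deriv (X ∘ Function.invFun φ) =
      (fun x => deriv X x * (deriv φ x)⁻¹) ∘ Function.invFun φ := by
    ext y
    exact deriv_comp_invFun hφ (space₁_differentiable hX) y
  rw [e]
  refine ht.comp_mem_space (mem_space_iff.2 ?_)
  exact (mem_space_iff.1 hX.2.1).mul (isControl_locallyControlled A) ht.controlled

/-! ### The `Ḣ¹`-metric and its Levi-Civita derivative -/

/-- Substituting `y = φ(x)`: two factors `1/φ'` come from the chain rule and one `φ'` from the
Jacobian. -/
lemma metricHdot_eq (hφ : φ ∈ (diffGroup A).carrier) {X Y : ℝ → ℝ} (hX : Differentiable ℝ X)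
    (hY : Differentiable ℝ Y) :
    metricHdot φ X Y = ∫ x, deriv X x * deriv Y x * (deriv φ x)⁻¹ := by
  rw [metricHdot, innerHdot, integral_comp_mul_deriv_of_bijective (bijective_of_diffGroup hφ)
    (hasDerivAt_of_diffGroup hφ) (deriv_pos_of_diffGroup hφ)]
  congr 1
  ext x
  have := (deriv_pos_of_diffGroup hφ x).ne'
  rw [deriv_comp_invFun hφ hX, deriv_comp_invFun hφ hY, leftInverse_invFun_of_diffGroup hφ x]
  field_simp

/-- The integrand of the `Ḣ¹`-metric in coordinates. -/
lemma controlled_deriv_mul (hc : c ∈ (diffGroup A).curves) (hh : h ∈ curves₁ A)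
    (hk : k ∈ curves₁ A) : Controlled (LocallyControlled A)
      (fun t x => deriv (h t) x * deriv (k t) x * (deriv (c t) x)⁻¹) :=
  ((controlled_spaceDeriv_of_curves₁ hh).mul_self (controlled_spaceDeriv_of_curves₁ hk)).mul
    (isControl_locallyControlled A) (controlled_inv_deriv hc)

lemma integrable_deriv_mul (hφ : φ ∈ (diffGroup A).carrier) {X Y : ℝ → ℝ} (hX : X ∈ space₁ A)
    (hY : Y ∈ space₁ A) : Integrable (fun x => deriv X x * deriv Y x * (deriv φ x)⁻¹) :=
  (controlled_deriv_mul (const_mem_curves_diffGroup hφ) (const_mem_curves₁ hX)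
    (const_mem_curves₁ hY)).integrable 0

lemma deriv_add_of_space₁ {X Y : ℝ → ℝ} (hX : X ∈ space₁ A) (hY : Y ∈ space₁ A) (x : ℝ) :
    deriv (X + Y) x = deriv X x + deriv Y x :=
  deriv_add (space₁_differentiable hX x) (space₁_differentiable hY x)

lemma deriv_smul_of_space₁ {X : ℝ → ℝ} (hX : X ∈ space₁ A) (a x : ℝ) :
    deriv (a • X) x = a * deriv X x :=
  ((space₁_differentiable hX x).hasDerivAt.const_smul a).deriv

lemma isRiemannianMetric_metricHdot (A : FunctionClass) :
    IsRiemannianMetric (diffGroup A) metricHdot := by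
  refine ⟨?_, ?_, ?_, ?_, ?_⟩
  · intro φ hφ h₁ h1 h₂ h2 k hk
    have d1 := space₁_differentiable h1
    have d2 := space₁_differentiable h2
    have dk := space₁_differentiable hk
    rw [metricHdot_eq hφ (d1.add d2) dk, metricHdot_eq hφ d1 dk, metricHdot_eq hφ d2 dk,
      ← integral_add (integrable_deriv_mul hφ h1 hk) (integrable_deriv_mul hφ h2 hk)]
    congr 1
    ext x
    rw [deriv_add_of_space₁ h1 h2]
    ring
  · intro φ hφ a h hh k hk
    have dh := space₁_differentiable hh
    have dk := space₁_differentiable hk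
    rw [metricHdot_eq hφ (dh.const_smul a) dk, metricHdot_eq hφ dh dk, ← integral_const_mul]
    congr 1
    ext x
    rw [deriv_smul_of_space₁ hh]
    ring
  · intro φ _ h _ k _
    simp only [metricHdot, innerHdot, mul_comm]
  · intro φ hφ h hh hne
    have dh := space₁_differentiable hh
    rw [metricHdot_eq hφ dh dh]
    refine integral_mul_self_pos (hh.1.continuous_deriv (by simp)) ?_
      (fun x => inv_pos.2 (deriv_pos_of_diffGroup hφ x)) (integrable_deriv_mul hφ hh hh) ?_
    · exact ((contDiff_of_diffGroup hφ).continuous_deriv (by simp)).inv₀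
        fun x => (deriv_pos_of_diffGroup hφ x).ne'
    -- If `h' = 0`, then `h = 0` because `h` vanishes at `-∞`; this makes the form definite.
    · intro h0
      refine hne (funext fun x => ?_)
      rw [← space₁_eq_integral hh x, h0]
      simp
  · intro c hc h hh k hk
    have e : (fun t => metricHdot (c t) (h t) (k t)) =
        fun t => ∫ x, deriv (h t) x * deriv (k t) x * (deriv (c t) x)⁻¹ := by
      ext t
      exact metricHdot_eq (hc.1 t) (space₁_differentiable (mem_space₁_of_curves₁ hh t))
        (space₁_differentiable (mem_space₁_of_curves₁ hk t))
    rw [e]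
    exact (controlled_deriv_mul hc hh hk).contDiff_integral

lemma isOpenInModel_diffGroup (A : FunctionClass) : IsOpenInModel (diffGroup A) where
  sub_mem h hh k hk := mem_space₁_sub hh hk
  const_mem h hh := const_mem_curves₁ hh
  carrier_of_curves c hc := hc.1
  exists_curve φ hφ h hh := by
    obtain ⟨s, hs, hse, hsb⟩ := exists_perturbation (by norm_num) hφ.1.2.1 hh.2.1 hφ.2
    have hA := isControl_locallyControlled A
    have d0 := space₁_differentiable hφ.1
    have d1 := space₁_differentiable hh
    have hd : ∀ t x, HasDerivAt (fun x => φ x + s t * h x - x)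
        (deriv (fun x => φ x - x) x + s t * deriv h x) x := by
      intro t x
      refine ((d0 x).hasDerivAt.add ((d1 x).hasDerivAt.const_mul (s t))).congr_of_eventuallyEq ?_
      exact Eventually.of_forall fun y => add_sub_right_comm (φ y) (s t * h y) y
    have hcurve : (fun t x => φ x + s t * h x - x) ∈ curves₁ A := by
      refine ⟨?_, ?_, fun t => ?_⟩
      · have h1 : ContDiff ℝ ∞ (fun p : ℝ × ℝ => (φ p.2 - p.2) + s p.1 * h p.2) :=
          (hφ.1.1.comp contDiff_snd).add ((hs.comp contDiff_fst).mul (hh.1.comp contDiff_snd))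
        convert h1 using 1
        ext p
        simp only [Function.uncurry]
        ring
      · rw [mem_curves_iff, show (fun t => deriv fun x => φ x + s t * h x - x) =
          (fun _ => deriv fun x => φ x - x) + (fun _ => deriv h) * fun t _ => s t by
            ext t x
            rw [(hd t x).deriv]
            simp [mul_comm]]
        exact (mem_space_iff.1 hφ.1.2.1).add hA
          ((mem_space_iff.1 hh.2.1).mul hA (Controlled.of_time hs))
      · have := hφ.1.2.2.add (hh.2.2.const_mul (s t))
        simp only [mul_zero, add_zero] at this
        refine this.congr fun x => ?_
        ring
    refine ⟨fun t x => φ x + s t * h x, ⟨fun t => ⟨mem_space₁_of_curves₁ hcurve t, fun x => ?_⟩,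
      hcurve⟩, ?_⟩
    · rw [(hd t x).deriv]
      exact hsb t x
    · filter_upwards [hse] with t ht
      ext x
      simp [ht]

/-- The Christoffel symbol `Γ_φ(h, k)(x) = -½ ∫_{-∞}^x h' k' / φ'` of the `Ḣ¹`-metric. -/
def christoffelHdot : Christoffel := fun φ h k x =>
  ∫ y in Iic x, -(1 / 2) * (deriv h y * deriv k y * (deriv φ y)⁻¹)

lemma controlled_christoffel (hc : c ∈ (diffGroup A).curves) (hh : h ∈ curves₁ A)
    (hk : k ∈ curves₁ A) : Controlled (LocallyControlled A)
      (fun t x => -(1 / 2) * (deriv (h t) x * deriv (k t) x * (deriv (c t) x)⁻¹)) :=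
  (controlled_deriv_mul hc hh hk).const_mul (isControl_locallyControlled A) _

lemma christoffelHdot_mem (hφ : φ ∈ (diffGroup A).carrier) {X Y : ℝ → ℝ} (hX : X ∈ space₁ A)
    (hY : Y ∈ space₁ A) : christoffelHdot φ X Y ∈ space₁ A :=
  mem_space₁_of_curves₁ (controlled_christoffel (const_mem_curves_diffGroup hφ)
    (const_mem_curves₁ hX) (const_mem_curves₁ hY)).antideriv_mem_curves₁ 0

lemma deriv_christoffelHdot (hφ : φ ∈ (diffGroup A).carrier) {X Y : ℝ → ℝ} (hX : X ∈ space₁ A)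
    (hY : Y ∈ space₁ A) (x : ℝ) : deriv (christoffelHdot φ X Y) x =
      -(1 / 2) * (deriv X x * deriv Y x * (deriv φ x)⁻¹) :=
  ((controlled_christoffel (const_mem_curves_diffGroup hφ) (const_mem_curves₁ hX)
    (const_mem_curves₁ hY)).hasDerivAt_antideriv 0 x).deriv

/-- The limit of `∂ₜ h` at `-∞` is not part of the definition; it follows from writing `h` as the
antiderivative of `∂ₓ h`. -/
lemma velocity_mem_curves₁ (hh : h ∈ curves₁ A) : velocity h ∈ curves₁ A := by
  have hd := controlled_spaceDeriv_of_curves₁ hh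
  have e : h = antideriv (spaceDeriv h) := by
    ext t x
    exact (space₁_eq_integral (mem_space₁_of_curves₁ hh t) x).symm
  rw [e, hd.velocity_antideriv]
  exact hd.velocity.antideriv_mem_curves₁

lemma velocity_mem_curves₁_of_diffGroup (hc : c ∈ (diffGroup A).curves) :
    velocity c ∈ curves₁ A := by
  have e : velocity (fun t x => c t x - x) = velocity c := by
    ext t x
    exact deriv_sub_const x
  rw [← e]
  exact velocity_mem_curves₁ hc.2

lemma hasDerivAt_inv_deriv (hc : c ∈ (diffGroup A).curves) (t x : ℝ) :
    HasDerivAt (fun s => (deriv (c s) x)⁻¹)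
      (-(deriv (velocity c t) x) * (deriv (c t) x)⁻¹ * (deriv (c t) x)⁻¹) t := by
  have hs := smooth₂_of_diffGroup hc
  have h1 := hs.spaceDeriv.hasDerivAt_left t x
  rw [hs.velocity_spaceDeriv] at h1
  have hne := (deriv_pos_of_diffGroup (hc.1 t) x).ne'
  refine (h1.inv hne).congr_deriv ?_
  simp only [spaceDeriv]
  field_simp

lemma hasDerivAt_deriv_mul (hc : c ∈ (diffGroup A).curves) (hh : h ∈ curves₁ A)
    (hk : k ∈ curves₁ A) (t x : ℝ) :
    HasDerivAt (fun s => deriv (h s) x * deriv (k s) x * (deriv (c s) x)⁻¹)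
      (deriv (velocity h t) x * deriv (k t) x * (deriv (c t) x)⁻¹ +
        deriv (h t) x * deriv (velocity k t) x * (deriv (c t) x)⁻¹ -
        deriv (h t) x * deriv (k t) x * deriv (velocity c t) x * (deriv (c t) x)⁻¹ *
          (deriv (c t) x)⁻¹) t := by
  have h1 := (Smooth₂.spaceDeriv hh.1).hasDerivAt_left t x
  have h2 := (Smooth₂.spaceDeriv hk.1).hasDerivAt_left t x
  rw [Smooth₂.velocity_spaceDeriv hh.1] at h1
  rw [Smooth₂.velocity_spaceDeriv hk.1] at h2
  refine ((h1.mul h2).mul (hasDerivAt_inv_deriv hc t x)).congr_deriv ?_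
  simp only [spaceDeriv, Pi.mul_apply]
  ring

/-- Differentiating `h'k'/c'` in time leaves the term `-h'k' ∂ₜc'/c'²`. Each of the two covariant
derivatives absorbs half of it, hence the factor `-½` in `Γ`. -/
lemma isLeviCivita_metricHdot (A : FunctionClass) :
    IsLeviCivita (diffGroup A) metricHdot christoffelHdot := by
  refine ⟨fun φ hφ h hh k hk => christoffelHdot_mem hφ hh hk,
    fun c hc h hh k hk => (controlled_christoffel hc hh hk).antideriv_mem_curves₁, ?_, ?_, ?_, ?_⟩
  · intro φ hφ h₁ h1 h₂ h2 k hk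
    ext x
    have i1 := (integrable_deriv_mul hφ h1 hk).const_mul (-(1 / 2))
    have i2 := (integrable_deriv_mul hφ h2 hk).const_mul (-(1 / 2))
    simp only [christoffelHdot, Pi.add_apply]
    rw [← integral_add i1.integrableOn i2.integrableOn]
    congr 1
    ext y
    rw [deriv_add_of_space₁ h1 h2]
    ring
  · intro φ _ a h hh k _
    ext x
    simp only [christoffelHdot, Pi.smul_apply, smul_eq_mul]
    rw [← integral_const_mul]
    congr 1
    ext y
    rw [deriv_smul_of_space₁ hh]
    ring
  · intro φ _ h _ k _
    ext x
    simp only [christoffelHdot]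
    congr 1
    ext y
    ring
  · intro c hc h hh k hk t
    have hcv := mem_space₁_of_curves₁ (velocity_mem_curves₁_of_diffGroup hc) t
    have hcov : ∀ h ∈ curves₁ A, ∀ k ∈ curves₁ A,
        Differentiable ℝ (covDeriv christoffelHdot c h t) ∧
        (∀ x, deriv (covDeriv christoffelHdot c h t) x = deriv (velocity h t) x +
          -(1 / 2) * (deriv (velocity c t) x * deriv (h t) x * (deriv (c t) x)⁻¹)) ∧
        Integrable (fun x => deriv (covDeriv christoffelHdot c h t) x * deriv (k t) x *
          (deriv (c t) x)⁻¹) := by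
      intro h hh k hk
      have hht := mem_space₁_of_curves₁ hh t
      have hkt := mem_space₁_of_curves₁ hk t
      have hv := mem_space₁_of_curves₁ (velocity_mem_curves₁ hh) t
      have hΓ := christoffelHdot_mem (hc.1 t) hcv hht
      have hd : ∀ x, deriv (covDeriv christoffelHdot c h t) x = deriv (velocity h t) x +
          deriv (christoffelHdot (c t) (velocity c t) (h t)) x := fun x =>
        deriv_add_of_space₁ hv hΓ x
      refine ⟨(space₁_differentiable hv).add (space₁_differentiable hΓ), fun x => ?_, ?_⟩
      · rw [hd, deriv_christoffelHdot (hc.1 t) hcv hht]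
      · refine ((integrable_deriv_mul (hc.1 t) hv hkt).add
          (integrable_deriv_mul (hc.1 t) hΓ hkt)).congr (Eventually.of_forall fun x => ?_)
        simp only [Pi.add_apply, hd]
        ring
    obtain ⟨dh, eh, ih⟩ := hcov h hh k hk
    obtain ⟨dk, ek, ik⟩ := hcov k hk h hh
    have ik' : Integrable (fun x => deriv (h t) x * deriv (covDeriv christoffelHdot c k t) x *
        (deriv (c t) x)⁻¹) := by
      simpa only [mul_comm (deriv (h t) _)] using ik
    have dht := space₁_differentiable (mem_space₁_of_curves₁ hh t)
    have dkt := space₁_differentiable (mem_space₁_of_curves₁ hk t)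
    have e : (fun s => metricHdot (c s) (h s) (k s)) =
        fun s => ∫ x, deriv (h s) x * deriv (k s) x * (deriv (c s) x)⁻¹ := by
      ext s
      exact metricHdot_eq (hc.1 s) (space₁_differentiable (mem_space₁_of_curves₁ hh s))
        (space₁_differentiable (mem_space₁_of_curves₁ hk s))
    rw [e, metricHdot_eq (hc.1 t) dh dkt, metricHdot_eq (hc.1 t) dht dk, ← integral_add ih ik']
    convert (controlled_deriv_mul hc hh hk).hasDerivAt_integral t using 1
    congr 1
    ext x
    rw [velocity, (hasDerivAt_deriv_mul hc hh hk t x).deriv, eh, ek]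
    ring

/-- The affine line is replaced by a genuine curve with the same germ at `0`, along which
differentiation under the integral is available. -/
lemma tangentMap_christoffelHdot (hφ : φ ∈ (diffGroup A).carrier) {X Y Z : ℝ → ℝ}
    (hX : X ∈ space₁ A) (hY : Y ∈ space₁ A) (hZ : Z ∈ space₁ A) (x : ℝ) :
    tangentMap (fun ψ => christoffelHdot ψ Y Z) φ X x =
      ∫ y in Iic x, 1 / 2 * (deriv X y * deriv Y y * deriv Z y * (deriv φ y)⁻¹ *
        (deriv φ y)⁻¹) := by
  obtain ⟨c, hc, he⟩ := (isOpenInModel_diffGroup A).exists_curve φ hφ X hX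
  have h0 : c 0 = φ := by simpa using he.self_of_nhds
  have hv := velocity_eq_of_eventually he
  have hY' := const_mem_curves₁ hY
  have hZ' := const_mem_curves₁ hZ
  have hF := controlled_christoffel hc hY' hZ'
  have e : tangentMap (fun ψ => christoffelHdot ψ Y Z) φ X x =
      deriv (fun t => christoffelHdot (c t) Y Z x) 0 := by
    refine EventuallyEq.deriv_eq ?_
    filter_upwards [he] with t ht
    rw [ht]
  rw [e]
  refine (hF.hasDerivAt_setIntegral (Iic x) 0).deriv.trans ?_
  congr 1
  ext y
  have hz : ∀ W : ℝ → ℝ, velocity (fun _ => W) 0 = fun _ => 0 := fun W => by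
    ext x; exact deriv_const 0 (W x)
  rw [velocity, ((hasDerivAt_deriv_mul hc hY' hZ' 0 y).const_mul (-(1 / 2))).deriv, hv, h0, hz, hz,
    deriv_const]
  ring

/-- Both `dΓ(h)(k, l)` and `Γ(h, Γ(k, l))` are multiples of the antiderivative of `h'k'l'/φ'²`,
symmetric in `h` and `k`. -/
lemma isFlat_diffGroup (A : FunctionClass) : IsFlat (diffGroup A) metricHdot := by
  refine isFlat_of_leviCivita (isRiemannianMetric_metricHdot A) (isLeviCivita_metricHdot A)
    (isOpenInModel_diffGroup A) fun φ hφ h hh k hk l hl => ?_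
  have e1 : tangentMap (fun ψ => christoffelHdot ψ k l) φ h =
      tangentMap (fun ψ => christoffelHdot ψ h l) φ k := by
    ext x
    rw [tangentMap_christoffelHdot hφ hh hk hl, tangentMap_christoffelHdot hφ hk hh hl]
    simp only [mul_comm (deriv h _) (deriv k _)]
  have e2 : christoffelHdot φ h (christoffelHdot φ k l) =
      christoffelHdot φ k (christoffelHdot φ h l) := by
    ext x
    rw [christoffelHdot, christoffelHdot]
    congr 1
    ext y
    rw [deriv_christoffelHdot hφ hk hl, deriv_christoffelHdot hφ hh hl]
    ring
  rw [curvature, e1, e2]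
  simp

end DiffGroup

/-! ### The map `R` and its inverse -/

section RMap

variable {A : FunctionClass} {φ γ : ℝ → ℝ} {c : ℝ → ℝ → ℝ}

lemma contDiffOn_sqrt_one_add : ContDiffOn ℝ ∞ (fun y : ℝ => √(1 + y)) (Ioi (-1)) := by
  intro y (hy : -1 < y)
  have h : 1 + y ≠ 0 := by linarith
  exact (ContDiffAt.sqrt (contDiff_const.add contDiff_id).contDiffAt h).contDiffWithinAt

lemma contDiffOn_rMap : ContDiffOn ℝ ∞ (fun y : ℝ => 2 * (√(1 + y) - 1)) (Ioi (-1)) :=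
  contDiffOn_const.mul (contDiffOn_sqrt_one_add.sub contDiffOn_const)

lemma controlled_rMap (hc : c ∈ (diffGroup A).curves) :
    Controlled (LocallyControlled A) (fun t => rMap (c t)) := by
  have := (controlled_deriv_sub_one hc).comp_outer_zero contDiffOn_rMap (by simp) (by norm_num)
    (locallyBoundedBelow_deriv_sub_one hc)
  simpa using! this

lemma neg_two_lt_rMap (hφ : φ ∈ (diffGroup A).carrier) (x : ℝ) : -2 < rMap φ x := by
  have := Real.sqrt_pos.2 (deriv_pos_of_diffGroup hφ x)
  rw [rMap]
  linarith

lemma rMap_mem (hφ : φ ∈ (diffGroup A).carrier) : rMap φ ∈ (target A).carrier :=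
  ⟨(controlled_rMap (const_mem_curves_diffGroup hφ)).mem_space 0, neg_two_lt_rMap hφ⟩

lemma isSmoothMap_rMap (A : FunctionClass) : IsSmoothMap (diffGroup A) (target A) rMap :=
  ⟨fun _ hφ => rMap_mem hφ, fun _ hc =>
    ⟨fun t => rMap_mem (hc.1 t), mem_curves_iff.2 (controlled_rMap hc)⟩⟩

lemma controlled_rInv (hc : Controlled (LocallyControlled A) c) :
    Controlled (LocallyControlled A) (fun t x => c t x ^ 2 + 4 * c t x) := by
  have hA := isControl_locallyControlled A
  have := (hc.mul_self hc).add hA (hc.const_mul hA 4)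
  simpa only [sq] using! this

lemma rInv_sub_id_eq (c : ℝ → ℝ → ℝ) : (fun t x => rInv (c t) x - x) =
    antideriv (fun t x => 1 / 4 * (c t x ^ 2 + 4 * c t x)) := by
  ext t x
  rw [rInv, add_sub_cancel_left, antideriv, integral_const_mul]

lemma rInv_mem_curves₁ (hc : Controlled (LocallyControlled A) c) :
    (fun t x => rInv (c t) x - x) ∈ curves₁ A := by
  rw [rInv_sub_id_eq]
  exact ((controlled_rInv hc).const_mul (isControl_locallyControlled A) _).antideriv_mem_curves₁

/-- Completing the square: `1 + (γ² + 4γ)/4 = (1 + γ/2)²`. For `γ > -2` the base is positive, so its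
square root can be undone. -/
lemma hasDerivAt_rInv (hγ : γ ∈ space A) (x : ℝ) :
    HasDerivAt (rInv γ) ((1 + γ x / 2) ^ 2) x := by
  have hγ := controlled_rInv (mem_space_iff.1 hγ)
  have h := (hasDerivAt_id x).add ((hγ.hasDerivAt_antideriv 0 x).const_mul (1 / 4))
  refine h.congr_deriv ?_
  ring

lemma rInv_mem (hγ : γ ∈ (target A).carrier) : rInv γ ∈ (diffGroup A).carrier := by
  refine ⟨mem_space₁_of_curves₁ (rInv_mem_curves₁ (mem_space_iff.1 hγ.1)) 0, fun x => ?_⟩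
  have hd : HasDerivAt (fun y => rInv γ y - y) _ x :=
    (hasDerivAt_rInv hγ.1 x).sub (hasDerivAt_id x)
  rw [hd.deriv]
  have : 0 < 1 + γ x / 2 := by linarith [hγ.2 x]
  linarith [pow_pos this 2]

lemma isSmoothMap_rInv (A : FunctionClass) : IsSmoothMap (target A) (diffGroup A) rInv :=
  ⟨fun _ hγ => rInv_mem hγ, fun _ hc =>
    ⟨fun t => rInv_mem (hc.1 t), rInv_mem_curves₁ (mem_curves_iff.1 hc.2)⟩⟩

lemma rMap_rInv (hγ : γ ∈ (target A).carrier) : rMap (rInv γ) = γ := by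
  ext x
  have : 0 < 1 + γ x / 2 := by linarith [hγ.2 x]
  rw [rMap, (hasDerivAt_rInv hγ.1 x).deriv, Real.sqrt_sq this.le]
  ring

lemma rInv_rMap (hφ : φ ∈ (diffGroup A).carrier) : rInv (rMap φ) = φ := by
  ext x
  -- With `γ = 2(√φ' - 1)` the identity is `(γ + 2)² = 4φ'`.
  have e : ∀ y, rMap φ y ^ 2 + 4 * rMap φ y = 4 * deriv (fun x => φ x - x) y := by
    intro y
    have := Real.sq_sqrt (deriv_pos_of_diffGroup hφ y).le
    rw [deriv_sub_id_of_diffGroup hφ, rMap]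
    linear_combination 4 * this
  simp only [rInv, e]
  rw [integral_const_mul, space₁_eq_integral hφ.1]
  ring

lemma invOn_rInv_rMap (A : FunctionClass) :
    InvOn rInv rMap (diffGroup A).carrier (target A).carrier :=
  ⟨fun _ hφ => rInv_rMap hφ, fun _ hγ => rMap_rInv hγ⟩

lemma bijOn_rMap (A : FunctionClass) : BijOn rMap (diffGroup A).carrier (target A).carrier :=
  (invOn_rInv_rMap A).bijOn (fun _ hφ => rMap_mem hφ) (fun _ hγ => rInv_mem hγ)

lemma tangentMap_rMap (hφ : φ ∈ (diffGroup A).carrier) {h : ℝ → ℝ} (hh : Differentiable ℝ h)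
    (x : ℝ) : tangentMap rMap φ h x = deriv h x * (√(deriv φ x))⁻¹ := by
  have hpos := deriv_pos_of_diffGroup hφ x
  have e : (fun t : ℝ => rMap (φ + t • h) x) =
      fun t => 2 * (√(deriv φ x + t * deriv h x) - 1) := by
    ext t
    rw [rMap, ((hasDerivAt_of_diffGroup hφ x).add ((hh x).hasDerivAt.const_smul t)).deriv]
    rfl
  have h1 : HasDerivAt (fun t : ℝ => deriv φ x + t * deriv h x) (deriv h x) 0 := by
    simpa using ((hasDerivAt_id (0 : ℝ)).mul_const (deriv h x)).const_add (deriv φ x)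
  have h2 := ((h1.sqrt (by simpa using hpos.ne')).sub_const 1).const_mul 2
  rw [tangentMap, e, h2.deriv]
  have := (Real.sqrt_pos.2 hpos).ne'
  simp only [zero_mul, add_zero]
  field_simp

/-- `tangentMap` is defined along affine lines only. At fixed `x` the value of `R` depends only on
`φ'(x)`, so exchanging `∂ₜ` and `∂ₓ` gives the chain rule along any curve. -/
lemma hasDerivAt_rMap (hc : c ∈ (diffGroup A).curves) (t x : ℝ) :
    HasDerivAt (fun s => rMap (c s) x) (tangentMap rMap (c t) (velocity c t) x) t := by
  have hs := smooth₂_of_diffGroup hc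
  have hpos := deriv_pos_of_diffGroup (hc.1 t) x
  rw [tangentMap_rMap (hc.1 t) ((hs.velocity.comp_right t).differentiable (by simp))]
  have h1 := hs.spaceDeriv.hasDerivAt_left t x
  rw [hs.velocity_spaceDeriv] at h1
  have h2 := ((h1.sqrt hpos.ne').sub_const 1).const_mul 2
  refine h2.congr_deriv ?_
  have := (Real.sqrt_pos.2 hpos).ne'
  simp only [spaceDeriv]
  field_simp

lemma tangentMap_rMap_mem (hφ : φ ∈ (diffGroup A).carrier) {h : ℝ → ℝ} (hh : h ∈ space₁ A) :
    tangentMap rMap φ h ∈ space A := by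
  have hc := const_mem_curves_diffGroup hφ
  have hd : ContDiffOn ℝ ∞ (fun y : ℝ => (√(1 + y))⁻¹) (Ioi (-1)) :=
    contDiffOn_inv_Ioi.comp contDiffOn_sqrt_one_add fun y (hy : -1 < y) =>
      Real.sqrt_pos.2 (by linarith)
  have h1 := (controlled_deriv_sub_one hc).locallyBounded.comp_outer hd
    (locallyBoundedBelow_deriv_sub_one hc)
  simp only [add_sub_cancel] at h1
  rw [mem_space_iff, show tangentMap rMap φ h = fun x => deriv h x * (√(deriv φ x))⁻¹ from
    funext fun x => tangentMap_rMap hφ (space₁_differentiable hh) x]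
  exact (mem_space_iff.1 hh.2.1).mul (isControl_locallyControlled A) h1

lemma pullback_rMap_metricL2 (hφ : φ ∈ (diffGroup A).carrier) {h k : ℝ → ℝ} (hh : h ∈ space₁ A)
    (hk : k ∈ space₁ A) : pullback rMap metricL2 φ h k = metricHdot φ h k := by
  have dh := space₁_differentiable hh
  have dk := space₁_differentiable hk
  rw [metricHdot_eq hφ dh dk, pullback, metricL2]
  congr 1
  ext x
  rw [tangentMap_rMap hφ dh, tangentMap_rMap hφ dk]
  -- The third occurrence is the one outside the square roots; splitting it as `√φ' · √φ'` matches
  -- the two factors `1/√φ'`.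
  nth_rewrite 3 [← Real.mul_self_sqrt (deriv_pos_of_diffGroup hφ x).le]
  rw [mul_inv]
  ring

/-! ### Openness of the target, and tangent spaces in right-trivialized form. -/

lemma exists_uniform_nhd_target (hγ : γ ∈ (target A).carrier) :
    ∃ ε > 0, ∀ η ∈ space A, (∀ x, |η x - γ x| < ε) → η ∈ (target A).carrier := by
  obtain ⟨ε, hε, hb⟩ := (mem_space_iff.1 hγ.1).exists_lower_bound (t := 0) (by norm_num) hγ.2
  refine ⟨ε, hε, fun η hη hd => ⟨hη, fun x => ?_⟩⟩
  linarith [hb x, (abs_lt.1 (hd x)).1]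

lemma isOpen_preimage_target (hc : c ∈ curves A) : IsOpen {t | c t ∈ (target A).carrier} := by
  have hc := mem_curves_iff.1 hc
  rw [isOpen_iff_mem_nhds]
  intro t ht
  obtain ⟨ε, hε, hb⟩ := hc.eventually_lower_bound (a := -2) (by norm_num) ht.2
  filter_upwards [hb] with s hs
  exact ⟨hc.mem_space s, fun x => by linarith [hs x]⟩

lemma image_comp_space₁ (hφ : φ ∈ (diffGroup A).carrier) :
    (fun X => X ∘ φ) '' space₁ A = (diffGroup A).model := by
  ext h
  constructor
  · rintro ⟨X, hX, rfl⟩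
    exact comp_mem_space₁ hφ hX
  · intro hh
    refine ⟨h ∘ Function.invFun φ, comp_invFun_mem_space₁ hφ hh, ?_⟩
    ext x
    exact congrArg h (leftInverse_invFun_of_diffGroup hφ x)

lemma metricHdot_comp (hφ : φ ∈ (diffGroup A).carrier) (X Y : ℝ → ℝ) :
    metricHdot φ (X ∘ φ) (Y ∘ φ) = ∫ x, deriv X x * deriv Y x := by
  have : φ ∘ Function.invFun φ = id := funext (rightInverse_invFun_of_diffGroup hφ)
  rw [metricHdot, innerHdot, Function.comp_assoc, Function.comp_assoc, this,
    Function.comp_id, Function.comp_id]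

end RMap

end SquareRootRep

end

theorem mainTheorem1 (A : SquareRootRep.FunctionClass) :
    -- `𝒜(ℝ, ℝ_{>-2})` is open in `𝒜(ℝ)`: for uniform convergence (hence for every finer
    -- topology) and for the final topology of the smooth curves
    ((∀ γ ∈ (SquareRootRep.target A).carrier, ∃ ε > 0, ∀ η ∈ SquareRootRep.space A,
        (∀ x, |η x - γ x| < ε) → η ∈ (SquareRootRep.target A).carrier) ∧
      ∀ c ∈ SquareRootRep.curves A, IsOpen {t | c t ∈ (SquareRootRep.target A).carrier}) ∧
    -- `R` is bijective with the given inverse, and both maps are smooth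
    (Set.BijOn SquareRootRep.rMap (SquareRootRep.diffGroup A).carrier
        (SquareRootRep.target A).carrier ∧
      (∀ γ ∈ (SquareRootRep.target A).carrier,
        MeasureTheory.Integrable (fun y => γ y ^ 2 + 4 * γ y)) ∧
      Set.InvOn SquareRootRep.rInv SquareRootRep.rMap (SquareRootRep.diffGroup A).carrier
        (SquareRootRep.target A).carrier ∧
      SquareRootRep.IsSmoothMap (SquareRootRep.diffGroup A) (SquareRootRep.target A)
        SquareRootRep.rMap ∧
      SquareRootRep.IsSmoothMap (SquareRootRep.target A) (SquareRootRep.diffGroup A)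
        SquareRootRep.rInv) ∧
    -- the tangent space at `φ` is `{X ∘ φ : X ∈ 𝒜₁(ℝ)}`, and on it the `Ḣ¹`-metric is `∫ X' Y'`
    (∀ φ ∈ (SquareRootRep.diffGroup A).carrier,
      Function.Bijective φ ∧
      (fun X => X ∘ φ) '' SquareRootRep.space₁ A = (SquareRootRep.diffGroup A).model ∧
      ∀ X ∈ SquareRootRep.space₁ A, ∀ Y ∈ SquareRootRep.space₁ A,
        MeasureTheory.Integrable (fun x => deriv X x * deriv Y x) ∧
        SquareRootRep.metricHdot φ (X ∘ φ) (Y ∘ φ) = ∫ x, deriv X x * deriv Y x) ∧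
    -- the tangent map of `R` differentiates `R` along every smooth curve
    (∀ c ∈ (SquareRootRep.diffGroup A).curves, ∀ t x : ℝ,
      HasDerivAt (fun s => SquareRootRep.rMap (c s) x)
        (SquareRootRep.tangentMap SquareRootRep.rMap (c t) (SquareRootRep.velocity c t) x) t) ∧
    -- the pullback of the `L²`-metric under `R` is the `Ḣ¹`-metric
    (∀ φ ∈ (SquareRootRep.diffGroup A).carrier, ∀ h ∈ (SquareRootRep.diffGroup A).model,
      SquareRootRep.tangentMap SquareRootRep.rMap φ h ∈ (SquareRootRep.target A).model ∧
      ∀ k ∈ (SquareRootRep.diffGroup A).model,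
        SquareRootRep.pullback SquareRootRep.rMap SquareRootRep.metricL2 φ h k
          = SquareRootRep.metricHdot φ h k) ∧
    -- flatness
    SquareRootRep.IsFlat (SquareRootRep.target A) SquareRootRep.metricL2 ∧
    SquareRootRep.IsFlat (SquareRootRep.diffGroup A) SquareRootRep.metricHdot := by
  open SquareRootRep in
  exact ⟨⟨fun _ hγ => exists_uniform_nhd_target hγ, fun _ hc => isOpen_preimage_target hc⟩,
    ⟨bijOn_rMap A, fun _ hγ => (controlled_rInv (mem_space_iff.1 hγ.1)).integrable 0,
      invOn_rInv_rMap A, isSmoothMap_rMap A, isSmoothMap_rInv A⟩,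
    fun _ hφ => ⟨bijective_of_diffGroup hφ, image_comp_space₁ hφ, fun X hX Y hY =>
      ⟨((mem_space_iff.1 hX.2.1).mul_self (mem_space_iff.1 hY.2.1)).integrable 0,
        metricHdot_comp hφ X Y⟩⟩,
    fun _ hc t x => hasDerivAt_rMap hc t x,
    fun _ hφ _ hh => ⟨tangentMap_rMap_mem hφ hh, fun _ hk => pullback_rMap_metricL2 hφ hh hk⟩,
    isFlat_target A, isFlat_diffGroup A⟩
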